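/- For a graph $G=(V,E)$ (finite, simple, undirected), a function $f:V\to\{0,1,2\}$ is a \emph{unique response Roman dominating function} if each vertex $v$ with $f(v)=0$ has exactly one neighbor $u$ with $f(u)=2$, and no vertex $v$ with $f(v)\ge 1$ has a neighbor $u$ with $f(u)=2$. \textbf{Theorem.} There is an algorithm that, given a graph $G$ of order $n$ without isolated vertices, enumerates all unique response Roman dominating functions of $G$, each exactly once, in polynomial space, with polynomial delay, and in time $\mathcal{O}^*(\sqrt{3}^{\,n})$. Precisely, there are a single program of a random access machine (finitely many registers, an unbounded memory, unit-cost instructions for constants, addition, truncated subtraction, indirect load and store, jumps and output; the input is $n$ together with the adjacency matrix of $G$ on the vertices $0,\dots,n-1$) and polynomials $d,s,q$ such that, for every $n$ and every such $G$, the program halts; its output is a list of all unique response Roman dominating functions of $G$, without repetition, each written as its sequence of $n$ values; the time from the start to the first output, between any two subsequent outputs, and from the last output to the end is at most $d(n)$; the registers and the memory together occupy at most $s(n)$ bits at any time (the write-only output is not counted); and the total running time is at most $q(n)\cdot\sqrt{3}^{\,n}$. -/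

import Mathlib

/-! Roman domination -/

/-- `f : V → {0,1,2}` is a Roman dominating function: each vertex of value 0 has a neighbor of
value 2. -/
def IsRomanDominating {V : Type*} (G : SimpleGraph V) (f : V → Fin 3) : Prop :=
  ∀ v, f v = 0 → ∃ u, G.Adj v u ∧ f u = 2

/-- A perfect Roman dominating function: a Roman dominating function such that each vertex of
value 0 has exactly one neighbor of value 2. -/
def IsPerfectRomanDominating {V : Type*} (G : SimpleGraph V) (f : V → Fin 3) : Prop :=
  IsRomanDominating G f ∧ ∀ v, f v = 0 → ∃! u, G.Adj v u ∧ f u = 2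

/-- A unique response Roman dominating function: a perfect Roman dominating function such that
no vertex of value at least 1 has a neighbor of value 2. -/
def IsUniqueResponseRomanDominating {V : Type*} (G : SimpleGraph V) (f : V → Fin 3) : Prop :=
  IsPerfectRomanDominating G f ∧ ∀ v, 1 ≤ f v → ∀ u, G.Adj v u → f u ≠ 2

/-! A random access machine with output.

The machine has registers and an unbounded memory; both hold natural numbers.  The arithmetic is
restricted to addition and truncated subtraction (no multiplication), and every instruction takes
one unit of time. -/

namespace RAM

/-- The instructions, written with `R` for the registers and `M` for the memory. -/
inductive Instr where
  /-- `R[d] := k` -/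
  | const (d k : ℕ)
  /-- `R[d] := R[a] + R[b]` -/
  | add (d a b : ℕ)
  /-- `R[d] := R[a] - R[b]`, or `0` if `R[a] < R[b]` -/
  | sub (d a b : ℕ)
  /-- `R[d] := M[R[a]]` -/
  | load (d a : ℕ)
  /-- `M[R[a]] := R[b]` -/
  | store (a b : ℕ)
  /-- go to instruction number `l` -/
  | jump (l : ℕ)
  /-- go to instruction number `l` if `R[a] = 0` -/
  | jumpZero (a l : ℕ)
  /-- write the number `R[a]` at the end of the current output item -/
  | write (a : ℕ)
  /-- complete the current output item, and start a new one, which is empty -/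
  | emit

/-- A program is a finite list of instructions, numbered from 0. -/
abbrev Program := List Instr

/-- A configuration: program counter, registers, memory, the output item that is being written,
and the list of the output items completed so far.  The machine cannot read its output. -/
structure Config where
  pc : ℕ
  reg : ℕ →₀ ℕ
  mem : ℕ →₀ ℕ
  buf : List ℕ
  out : List (List ℕ)

/-- The effect of one instruction. -/
noncomputable def exec (c : Config) : Instr → Config
  | .const d k => { c with pc := c.pc + 1, reg := c.reg.update d k }
  | .add d a b => { c with pc := c.pc + 1, reg := c.reg.update d (c.reg a + c.reg b) }
  | .sub d a b => { c with pc := c.pc + 1, reg := c.reg.update d (c.reg a - c.reg b) }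
  | .load d a => { c with pc := c.pc + 1, reg := c.reg.update d (c.mem (c.reg a)) }
  | .store a b => { c with pc := c.pc + 1, mem := c.mem.update (c.reg a) (c.reg b) }
  | .jump l => { c with pc := l }
  | .jumpZero a l => { c with pc := if c.reg a = 0 then l else c.pc + 1 }
  | .write a => { c with pc := c.pc + 1, buf := c.buf ++ [c.reg a] }
  | .emit => { c with pc := c.pc + 1, buf := [], out := c.out ++ [c.buf] }

/-- The machine has halted if the program counter points to no instruction. -/
def Halted (P : Program) (c : Config) : Prop := P[c.pc]? = none

/-- One step of the program; a halted machine stays as it is. -/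
noncomputable def step (P : Program) (c : Config) : Config :=
  match P[c.pc]? with
  | none => c
  | some i => exec c i

/-- The configuration after `t` steps from `c`. -/
noncomputable def run (P : Program) (c : Config) (t : ℕ) : Config := (step P)^[t] c

/-- Started in `c`, the program runs for exactly `T` steps. -/
def HaltsAfter (P : Program) (c : Config) (T : ℕ) : Prop :=
  Halted P (run P c T) ∧ ∀ t < T, ¬ Halted P (run P c t)

/-- An output item is completed by the `t`-th step (steps are counted from 1). -/
def OutputAt (P : Program) (c : Config) (t : ℕ) : Prop :=
  ∃ s, t = s + 1 ∧ P[(run P c s).pc]? = some Instr.emit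

/-- The moments between which delays are measured, for a run of `T` steps: the start, the
completions of output items, and the end. -/
def IsEvent (P : Program) (c : Config) (T t : ℕ) : Prop :=
  t = 0 ∨ (t ≤ T ∧ OutputAt P c t) ∨ t = T

/-- In the run of `T` steps from `c`, the time from the start to the first output, between any two
subsequent outputs, and from the last output to the end is at most `D`. -/
def DelayAtMost (P : Program) (c : Config) (T D : ℕ) : Prop :=
  ∀ a b, IsEvent P c T a → IsEvent P c T b → a < b →
    (∀ t, a < t → t < b → ¬ IsEvent P c T t) → b - a ≤ D

/-- The number of bits in an assignment of numbers to addresses: each address whose content is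
not 0 counts with the binary lengths of the address and of the content. -/
def bits (m : ℕ →₀ ℕ) : ℕ := ∑ a ∈ m.support, (Nat.size a + Nat.size (m a))

/-- The space that a configuration occupies, in bits (the write-only output is not counted). -/
def space (c : Config) : ℕ := bits c.reg + bits c.mem

end RAM

open Classical in
/-- The adjacency matrix of a graph with vertices `0, …, n - 1`, row by row: cell `i * n + j`
holds 1 if `i` and `j` are adjacent; all other cells hold 0. -/
noncomputable def adjacencyMemory {n : ℕ} (G : SimpleGraph (Fin n)) : ℕ →₀ ℕ :=
  Finsupp.onFinset (Finset.range (n * n))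
    (fun k => if ∃ i j : Fin n, G.Adj i j ∧ k = i * n + j then 1 else 0) (by
      intro k hk
      have h : ∃ i j : Fin n, G.Adj i j ∧ k = i * n + j := by
        by_contra h
        exact hk (if_neg h)
      obtain ⟨i, j, -, rfl⟩ := h
      have hi : ((i : ℕ) + 1) * n ≤ n * n := Nat.mul_le_mul_right n i.isLt
      have hj := j.isLt
      rw [Finset.mem_range]
      nlinarith)

/-- The start of a run on the graph `G`: register 0 holds the order `n`, the other registers
hold 0, the memory holds the adjacency matrix, and nothing has been output. -/
noncomputable def graphInput {n : ℕ} (G : SimpleGraph (Fin n)) : RAM.Config where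
  pc := 0
  reg := Finsupp.single 0 n
  mem := adjacencyMemory G
  buf := []
  out := []

/-- The output item for `f : {0, …, n - 1} → {0,1,2}`: its `n` values in order. -/
def valueList {n : ℕ} (f : Fin n → Fin 3) : List ℕ := List.ofFn fun v => (f v : ℕ)

/-- On the graph `G`, the program `P` halts after `T` steps, and until then it outputs the
functions that satisfy `S`, each exactly once, and nothing else. -/
def EnumeratesInTime (P : RAM.Program) {n : ℕ} (G : SimpleGraph (Fin n))
    (S : (Fin n → Fin 3) → Prop) (T : ℕ) : Prop :=
  RAM.HaltsAfter P (graphInput G) T ∧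
  (RAM.run P (graphInput G) T).buf = [] ∧
  ∃ L : List (Fin n → Fin 3), L.Nodup ∧ (∀ f, f ∈ L ↔ S f) ∧
    (RAM.run P (graphInput G) T).out = L.map valueList

/-! A unique response Roman dominating function is determined by its set of vertices of value 2. The
sets that occur are exactly the packings: a vertex of value 2 forces 0 on its neighbors, and
uniqueness of the response makes the closed neighborhoods disjoint (`IsPacking.isUniqueResponse`,
`IsUniqueResponseRomanDominating.exists_packing`). It remains to enumerate packings.

Packings are closed under taking subsets, so every initial part of a packing is itself a packing and
a search has no dead ends. The lexicographic successor of a packing `S` is `insert i (below S i)`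
for the largest `i ∉ S` for which this is a packing (`NoExtensionFrom.lexLT_cases`). One backward
scan over the vertices finds it in time O(n²). Only the current packing is stored, as marks on the
vertices; removing the last element is reversible from the marks alone (`packingMark_of_insert`), so
no stack is needed. An instruction adds at most one cell and one bit per number, hence polynomial
delay also keeps the space polynomial (`Bounded.run`).

For the total time, the packings are counted. If the closed neighborhoods of the vertices of a block
`B` pairwise intersect, a packing contains at most one vertex of `B`, so `B` contributes a factor
`|B| + 1`, which is at most `√3 ^ |B|` once `|B| ≥ 2`. Without isolated vertices, the vertex set
splits into such blocks (`exists_block`), so there are at most `√3 ^ n` packings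
(`card_packingsIn_le`). -/

/-! Packings: sets of vertices with pairwise disjoint closed neighborhoods. -/

section Packing

variable {V : Type*}

/-- `w` lies in the closed neighborhood of `u`. -/
def InClosedNbhd (G : SimpleGraph V) (u w : V) : Prop := u = w ∨ G.Adj u w

/-- The closed neighborhoods of the vertices in `S` are pairwise disjoint. -/
def IsPacking (G : SimpleGraph V) (S : Finset V) : Prop :=
  ∀ w, ∀ u ∈ S, ∀ v ∈ S, InClosedNbhd G u w → InClosedNbhd G v w → u = v

theorem IsPacking.subset {G : SimpleGraph V} {S R : Finset V} (h : IsPacking G R) (hs : S ⊆ R) :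
    IsPacking G S :=
  fun w u hu v hv => h w u (hs hu) v (hs hv)

theorem isPacking_empty (G : SimpleGraph V) : IsPacking G ∅ := by
  intro w u hu
  simp at hu

/-- Equality holds at `k = 2`, which is where the base `√3` comes from; at `k = 1` the inequality
fails, so blocks need at least two vertices. -/
theorem succ_le_sqrt_three_pow (k : ℕ) (hk : 2 ≤ k) : ((k : ℝ) + 1) ≤ Real.sqrt 3 ^ k := by
  have h3 : Real.sqrt 3 ^ 2 = 3 := Real.sq_sqrt (by norm_num)
  have h15 : (3 / 2 : ℝ) ≤ Real.sqrt 3 := Real.le_sqrt_of_sq_le (by norm_num)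
  induction k, hk using Nat.le_induction with
  | base => rw [h3]; norm_num
  | succ k hk ih =>
    rw [pow_succ]
    push_cast
    have hk' : (2 : ℝ) ≤ k := by exact_mod_cast hk
    nlinarith

open Classical in
/-- The packings of `G` inside `U`. -/
noncomputable def packingsIn (G : SimpleGraph V) (U : Finset V) : Finset (Finset V) :=
  U.powerset.filter (IsPacking G)

theorem mem_packingsIn {G : SimpleGraph V} {U S : Finset V} :
    S ∈ packingsIn G U ↔ S ⊆ U ∧ IsPacking G S := by
  simp [packingsIn]

/-- A set whose vertices pairwise have intersecting closed neighborhoods contains at most one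
vertex of a packing. -/
theorem card_packingsIn_le_mul [DecidableEq V] (G : SimpleGraph V) (U B : Finset V)
    (hB : ∀ u ∈ B, ∀ v ∈ B, ∃ w, InClosedNbhd G u w ∧ InClosedNbhd G v w) :
    (packingsIn G U).card ≤ (B.card + 1) * (packingsIn G (U \ B)).card := by
  have h1 : (packingsIn G U).card ≤
      ((insert ∅ (B.image fun b => ({b} : Finset V))) ×ˢ packingsIn G (U \ B)).card := by
    -- A packing is recovered from its traces on `B` and off `B`; the trace on `B` is empty or a
    -- singleton.
    apply Finset.card_le_card_of_injOn (fun S => (S ∩ B, S \ B))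
    · intro S hS
      obtain ⟨hSU, hS⟩ := mem_packingsIn.1 hS
      simp only [Finset.coe_product, Set.mem_prod, Finset.mem_coe, mem_packingsIn]
      refine ⟨?_, Finset.sdiff_subset_sdiff hSU le_rfl, hS.subset Finset.sdiff_subset⟩
      rcases (S ∩ B).eq_empty_or_nonempty with h | ⟨b, hb⟩
      · simp [h]
      · refine Finset.mem_insert_of_mem (Finset.mem_image.2 ⟨b, (Finset.mem_inter.1 hb).2, ?_⟩)
        ext c
        rw [Finset.mem_singleton]
        constructor
        · rintro rfl
          exact hb
        · intro hc
          rw [Finset.mem_inter] at hb hc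
          obtain ⟨w, hw⟩ := hB c hc.2 b hb.2
          exact hS w c hc.1 b hb.1 hw.1 hw.2
    · intro S _ R _ h
      simp only [Prod.mk.injEq] at h
      rw [← Finset.sdiff_union_inter S B, ← Finset.sdiff_union_inter R B, h.1, h.2]
  refine h1.trans ?_
  rw [Finset.card_product]
  refine Nat.mul_le_mul_right _ ((Finset.card_insert_le _ _).trans ?_)
  exact Nat.succ_le_succ Finset.card_image_le

/-- A nonempty set of vertices without isolated vertices contains a block of at least two vertices
with pairwise intersecting closed neighborhoods whose removal isolates no vertex. -/
theorem exists_block [DecidableEq V] (G : SimpleGraph V) (U : Finset V) (hne : U.Nonempty)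
    (hU : ∀ v ∈ U, ∃ w ∈ U, G.Adj v w) :
    ∃ B ⊆ U, 2 ≤ B.card ∧
      (∀ u ∈ B, ∀ v ∈ B, ∃ w, InClosedNbhd G u w ∧ InClosedNbhd G v w) ∧
      ∀ v ∈ U \ B, ∃ w ∈ U \ B, G.Adj v w := by
  classical
  -- If some vertex has a single neighbor `v` within `U`, the block is the star of `v` and all
  -- leaves attached to it. Otherwise all degrees within `U` are at least 2, and the block is built
  -- on an edge.
  by_cases hleaf : ∃ x ∈ U, ∃ v ∈ U, G.Adj x v ∧ ∀ y ∈ U, G.Adj x y → y = v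
  · obtain ⟨x, hx, v, hv, hxv, hxl⟩ := hleaf
    let L : Finset V := U.filter fun y => G.Adj y v ∧ ∀ z ∈ U, G.Adj y z → z = v
    have hL : ∀ y, y ∈ L ↔ y ∈ U ∧ G.Adj y v ∧ ∀ z ∈ U, G.Adj y z → z = v := by simp [L]
    have hin : ∀ u ∈ insert v L, InClosedNbhd G u v := by
      intro u hu
      rcases Finset.mem_insert.1 hu with rfl | hu
      · exact Or.inl rfl
      · exact Or.inr ((hL u).1 hu).2.1
    refine ⟨insert v L, ?_, ?_, fun u hu w hw => ⟨v, hin u hu, hin w hw⟩, ?_⟩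
    · exact Finset.insert_subset hv (Finset.filter_subset _ _)
    · have : ({v, x} : Finset V) ⊆ insert v L := by
        refine Finset.insert_subset_insert _ (Finset.singleton_subset_iff.2 ?_)
        exact (hL x).2 ⟨hx, hxv, hxl⟩
      rw [← Finset.card_pair hxv.ne']
      exact Finset.card_le_card this
    · intro y hy
      rw [Finset.mem_sdiff, Finset.mem_insert, not_or] at hy
      obtain ⟨hyU, hyv, hyL⟩ := hy
      by_contra! hno
      -- A neighbor of `y` in `L` has `v` as its only neighbor in `U`, which would force `y = v`. So
      -- an isolated leftover `y` is a leaf at `v`, hence already in `L`.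
      have hall : ∀ z ∈ U, G.Adj y z → z = v := by
        intro z hz hyz
        by_contra hzv
        have hzL : z ∈ L := by
          by_contra hzL
          exact hno z (by simp [hz, hzv, hzL]) hyz
        exact hyv (((hL z).1 hzL).2.2 y hyU hyz.symm)
      obtain ⟨z, hz, hyz⟩ := hU y hyU
      exact hyL ((hL y).2 ⟨hyU, hall z hz hyz ▸ hyz, hall⟩)
  · push Not at hleaf
    obtain ⟨v, hv⟩ := hne
    obtain ⟨w, hw, hvw⟩ := hU v hv
    -- These are the vertices that removing only `v` and `w` would isolate. All of them see `v`, so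
    -- they can join the block; since their neighbors in `U` are only `v` and `w`, removing them
    -- isolates nothing further.
    let X : Finset V := U.filter fun y => G.Adj y v ∧ G.Adj y w ∧
      ∀ z ∈ U, G.Adj y z → z = v ∨ z = w
    have hX : ∀ y, y ∈ X ↔ y ∈ U ∧ G.Adj y v ∧ G.Adj y w ∧
      ∀ z ∈ U, G.Adj y z → z = v ∨ z = w := by simp [X]
    have hin : ∀ u ∈ insert v (insert w X), InClosedNbhd G u v := by
      intro u hu
      rcases Finset.mem_insert.1 hu with rfl | hu
      · exact Or.inl rfl
      · rcases Finset.mem_insert.1 hu with rfl | hu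
        · exact Or.inr hvw.symm
        · exact Or.inr ((hX u).1 hu).2.1
    refine ⟨insert v (insert w X), ?_, ?_, fun u hu w hw => ⟨v, hin u hu, hin w hw⟩, ?_⟩
    · exact Finset.insert_subset hv (Finset.insert_subset hw (Finset.filter_subset _ _))
    · rw [← Finset.card_pair hvw.ne]
      refine Finset.card_le_card (Finset.insert_subset_insert _ ?_)
      simp
    · intro y hy
      rw [Finset.mem_sdiff, Finset.mem_insert, Finset.mem_insert, not_or, not_or] at hy
      obtain ⟨hyU, hyv, hyw, hyX⟩ := hy
      by_contra! hno
      have hall : ∀ z ∈ U, G.Adj y z → z = v ∨ z = w := by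
        intro z hz hyz
        by_contra hzv
        rw [not_or] at hzv
        have hzX : z ∈ X := by
          by_contra hzX
          exact hno z (by simp [hz, hzv, hzX]) hyz
        rcases ((hX z).1 hzX).2.2.2 y hyU hyz.symm with h | h
        · exact hyv h
        · exact hyw h
      apply hyX
      rw [hX]
      obtain ⟨z, hz, hyz⟩ := hU y hyU
      obtain ⟨z', hz', hyz', hne⟩ := hleaf y hyU z hz hyz
      rcases hall z hz hyz with rfl | rfl <;> rcases hall z' hz' hyz' with rfl | rfl
      · exact absurd rfl hne
      · exact ⟨hyU, hyz, hyz', hall⟩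
      · exact ⟨hyU, hyz', hyz, hall⟩
      · exact absurd rfl hne

/-- Blocks are split off one by one; the leftover again has no isolated vertices, so the induction
continues. -/
theorem card_packingsIn_le [DecidableEq V] (G : SimpleGraph V) (U : Finset V)
    (hU : ∀ v ∈ U, ∃ w ∈ U, G.Adj v w) :
    ((packingsIn G U).card : ℝ) ≤ Real.sqrt 3 ^ U.card := by
  induction U using Finset.strongInduction with
  | H U ih =>
    rcases U.eq_empty_or_nonempty with rfl | hne
    · have : packingsIn G ∅ ⊆ {∅} := fun S hS => by
        simpa [Finset.subset_empty] using (mem_packingsIn.1 hS).1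
      simpa using Finset.card_le_card this
    · obtain ⟨B, hBU, hB2, hB, hrest⟩ := exists_block G U hne hU
      have hlt : U \ B ⊂ U :=
        Finset.sdiff_ssubset hBU (Finset.card_pos.1 (by omega))
      have h1 : ((packingsIn G U).card : ℝ) ≤ (B.card + 1) * (packingsIn G (U \ B)).card := by
        exact_mod_cast card_packingsIn_le_mul G U B hB
      have h2 : U.card = B.card + (U \ B).card := by
        rw [Finset.card_sdiff_of_subset hBU]
        have := Finset.card_le_card hBU
        omega
      rw [h2, pow_add]
      refine h1.trans (mul_le_mul (succ_le_sqrt_three_pow _ hB2) (ih _ hlt hrest)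
        (by positivity) (by positivity))

open Classical in
/-- The function that is 2 on `S`, 0 on the other neighbors of `S`, and 1 elsewhere. -/
noncomputable def packingFun (G : SimpleGraph V) (S : Finset V) (v : V) : Fin 3 :=
  if v ∈ S then 2 else if ∃ u ∈ S, G.Adj u v then 0 else 1

theorem packingFun_eq_two {G : SimpleGraph V} {S : Finset V} {v : V} :
    packingFun G S v = 2 ↔ v ∈ S := by
  unfold packingFun
  split_ifs <;> simp_all

theorem packingFun_eq_zero {G : SimpleGraph V} {S : Finset V} {v : V} :
    packingFun G S v = 0 ↔ v ∉ S ∧ ∃ u ∈ S, G.Adj u v := by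
  unfold packingFun
  split_ifs <;> simp_all

theorem packingFun_injective (G : SimpleGraph V) : Function.Injective (packingFun G) := by
  intro S R h
  ext v
  rw [← packingFun_eq_two (G := G), h, packingFun_eq_two]

theorem IsPacking.isUniqueResponse {G : SimpleGraph V} {S : Finset V} (hS : IsPacking G S) :
    IsUniqueResponseRomanDominating G (packingFun G S) := by
  refine ⟨⟨?_, ?_⟩, ?_⟩
  · intro v hv
    obtain ⟨-, u, hu, huv⟩ := packingFun_eq_zero.1 hv
    exact ⟨u, huv.symm, packingFun_eq_two.2 hu⟩
  · intro v hv
    obtain ⟨-, u, hu, huv⟩ := packingFun_eq_zero.1 hv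
    refine ⟨u, ⟨huv.symm, packingFun_eq_two.2 hu⟩, ?_⟩
    rintro w ⟨hvw, hw⟩
    exact hS v w (packingFun_eq_two.1 hw) u hu (Or.inr hvw.symm) (Or.inr huv)
  · intro v hv u hvu hu
    rw [packingFun_eq_two] at hu
    have h0 : packingFun G S v ≠ 0 := by
      intro h
      rw [h] at hv
      exact absurd hv (by decide)
    have hvS : v ∈ S := by
      by_contra hvS
      exact h0 (packingFun_eq_zero.2 ⟨hvS, u, hu, hvu.symm⟩)
    exact hvu.ne (hS v v hvS u hu (Or.inl rfl) (Or.inr hvu.symm))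

/-- Two closed neighborhoods of vertices of value 2 can meet neither in one of these vertices, as
all neighbors of such a vertex have value 0, nor in a vertex of value 0, whose response is unique.
-/
theorem IsUniqueResponseRomanDominating.exists_packing [Fintype V] {G : SimpleGraph V}
    {f : V → Fin 3} (hf : IsUniqueResponseRomanDominating G f) :
    ∃ S, IsPacking G S ∧ packingFun G S = f := by
  classical
  obtain ⟨⟨hdom, huniq⟩, hresp⟩ := hf
  have hzero : ∀ u v, f u = 2 → G.Adj u v → f v = 0 := by
    intro u v hu huv
    by_contra hv
    exact hresp v (Fin.pos_iff_ne_zero.2 hv) u huv.symm hu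
  refine ⟨Finset.univ.filter fun v => f v = 2, ?_, ?_⟩
  · intro w u hu v hv huw hvw
    simp only [Finset.mem_filter, Finset.mem_univ, true_and] at hu hv
    rcases huw with rfl | huw <;> rcases hvw with rfl | hvw
    · rfl
    · rw [hzero v u hv hvw] at hu
      exact absurd hu (by decide)
    · rw [hzero u v hu huw] at hv
      exact absurd hv (by decide)
    · exact (huniq w (hzero u w hu huw)).unique ⟨huw.symm, hu⟩ ⟨hvw.symm, hv⟩
  · funext v
    unfold packingFun
    simp only [Finset.mem_filter, Finset.mem_univ, true_and]
    split_ifs with h2 h0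
    · exact h2.symm
    · obtain ⟨u, hu, huv⟩ := h0
      exact (hzero u v hu huv).symm
    · have hv0 : f v ≠ 0 := fun h => by
        obtain ⟨u, hvu, hu⟩ := hdom v h
        exact h0 ⟨u, hu, hvu.symm⟩
      generalize f v = x at h2 hv0
      revert x
      decide

end Packing

/-! The lexicographic order of the subsets of `{0, …, n - 1}`. -/

section Lex

variable {n : ℕ}

/-- `S` precedes `R` in the lexicographic order of the indicator functions. -/
def LexLT (S R : Finset (Fin n)) : Prop :=
  ∃ k, (∀ j < k, j ∈ S ↔ j ∈ R) ∧ k ∉ S ∧ k ∈ R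

theorem LexLT.irrefl (S : Finset (Fin n)) : ¬ LexLT S S := by
  rintro ⟨k, -, h, h'⟩
  exact h h'

theorem LexLT.trans {S R Q : Finset (Fin n)} (h₁ : LexLT S R) (h₂ : LexLT R Q) : LexLT S Q := by
  obtain ⟨k, hk, hkS, hkR⟩ := h₁
  obtain ⟨l, hl, hlR, hlQ⟩ := h₂
  rcases lt_trichotomy k l with h | rfl | h
  · exact ⟨k, fun j hj => (hk j hj).trans (hl j (hj.trans h)), hkS, (hl k h).1 hkR⟩
  · exact absurd hkR hlR
  · exact ⟨l, fun j hj => (hk j (hj.trans h)).trans (hl j hj), fun h' => hlR ((hk l h).1 h'), hlQ⟩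

theorem LexLT.empty {S : Finset (Fin n)} (hS : S ≠ ∅) : LexLT ∅ S := by
  have hne := Finset.nonempty_iff_ne_empty.2 hS
  refine ⟨S.min' hne, fun j hj => ?_, by simp, S.min'_mem hne⟩
  simp only [Finset.notMem_empty, false_iff]
  exact fun h => absurd (S.min'_le j h) (not_le.2 hj)

/-- The elements of `S` less than `k`. -/
def below (S : Finset (Fin n)) (k : ℕ) : Finset (Fin n) := S.filter fun v => (v : ℕ) < k

theorem mem_below {S : Finset (Fin n)} {k : ℕ} {v : Fin n} :
    v ∈ below S k ↔ v ∈ S ∧ (v : ℕ) < k := by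
  simp [below]

/-- No vertex from `k` on can be added to the part of `S` before it. -/
def NoExtensionFrom (G : SimpleGraph (Fin n)) (S : Finset (Fin n)) (k : ℕ) : Prop :=
  ∀ j : Fin n, k ≤ j → j ∉ S → ¬ IsPacking G (insert j (below S j))

/-- At the first difference `k`, the set on the left lies inside `R`. Thus every later packing
exhibits an extension of an initial part of `S`. -/
theorem LexLT.isPacking_insert {G : SimpleGraph (Fin n)} {S R : Finset (Fin n)}
    (hR : IsPacking G R) {k : Fin n} (hk : ∀ j < k, j ∈ S ↔ j ∈ R) (hkR : k ∈ R) :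
    IsPacking G (insert k (below S k)) := by
  refine hR.subset (Finset.insert_subset hkR fun j hj => ?_)
  rw [mem_below] at hj
  exact (hk j hj.2).1 hj.1

theorem NoExtensionFrom.not_lexLT {G : SimpleGraph (Fin n)} {S R : Finset (Fin n)}
    (h : NoExtensionFrom G S 0) (hR : IsPacking G R) : ¬ LexLT S R := by
  rintro ⟨k, hk, hkS, hkR⟩
  exact h k (Nat.zero_le _) hkS (LexLT.isPacking_insert hR hk hkR)

theorem lexLT_insert_below {S : Finset (Fin n)} {i : Fin n} (hi : i ∉ S) :
    LexLT S (insert i (below S i)) := by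
  refine ⟨i, fun j hj => ?_, hi, Finset.mem_insert_self _ _⟩
  rw [Finset.mem_insert, mem_below]
  have hji : j ≠ i := hj.ne
  have : (j : ℕ) < i := hj
  tauto

/-- No packing lies strictly between `S` and `insert i (below S i)`. The first difference of `S` and
`R` cannot exceed `i`; if it is smaller, `R` also comes after the new set; if it is `i`, then `R`
agrees with the new set up to `i`, and the new set is the least such set because it has no elements
beyond `i`. -/
theorem NoExtensionFrom.lexLT_cases {G : SimpleGraph (Fin n)} {S R : Finset (Fin n)} {i : Fin n}
    (h : NoExtensionFrom G S (i + 1)) (hR : IsPacking G R) (hSR : LexLT S R) :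
    R = insert i (below S i) ∨ LexLT (insert i (below S i)) R := by
  obtain ⟨k, hk, hkS, hkR⟩ := hSR
  have hki : k ≤ i := by
    by_contra hki
    exact h k (not_le.1 hki) hkS (LexLT.isPacking_insert hR hk hkR)
  rcases hki.lt_or_eq with hki | rfl
  · right
    refine ⟨k, fun j hj => ?_, ?_, hkR⟩
    · rw [← hk j hj, Finset.mem_insert, mem_below]
      have hji : j ≠ i := (hj.trans hki).ne
      have : (j : ℕ) < i := hj.trans hki
      tauto
    · rw [Finset.mem_insert, mem_below]
      have := hki.ne
      tauto
  · by_cases hlast : ∃ j ∈ R, k < j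
    · right
      -- The least element of `R` beyond `k` is the first place where `R` differs from the new set.
      have hne : (R.filter (k < ·)).Nonempty := by
        obtain ⟨j, hj⟩ := hlast
        exact ⟨j, Finset.mem_filter.2 hj⟩
      have hmem := Finset.mem_filter.1 (Finset.min'_mem _ hne)
      refine ⟨(R.filter (k < ·)).min' hne, fun j hj => ?_, ?_, hmem.1⟩
      · rw [Finset.mem_insert, mem_below]
        rcases lt_trichotomy j k with h' | rfl | h'
        · rw [← hk j h']
          have : (j : ℕ) < k := h'
          have := h'.ne
          tauto
        · simp [hkR]
        · have hjR : j ∉ R := fun hjR =>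
            absurd (Finset.min'_le _ j (Finset.mem_filter.2 ⟨hjR, h'⟩)) (not_le.2 hj)
          have : ¬ (j : ℕ) < k := not_lt.2 h'.le
          have := h'.ne'
          tauto
      · rw [Finset.mem_insert, mem_below]
        have h1 : ¬ (((R.filter (k < ·)).min' hne : Fin n) : ℕ) < k := not_lt.2 hmem.2.le
        have h2 := hmem.2.ne'
        tauto
    · left
      ext j
      rw [Finset.mem_insert, mem_below]
      rcases lt_trichotomy j k with h' | rfl | h'
      · rw [← hk j h']
        have : (j : ℕ) < k := h'
        have := h'.ne
        tauto
      · simp [hkR]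
      · have hjR : j ∉ R := fun hjR => hlast ⟨j, hjR, h'⟩
        have : ¬ (j : ℕ) < k := not_lt.2 h'.le
        have := h'.ne'
        tauto

end Lex

/-! ### Runs of the machine: composition of runs. -/

namespace RAM

theorem run_add (P : Program) (c : Config) (s t : ℕ) : run P c (s + t) = run P (run P c s) t := by
  unfold run
  rw [Nat.add_comm, Function.iterate_add_apply]

theorem run_succ (P : Program) (c : Config) (t : ℕ) : run P c (t + 1) = step P (run P c t) :=
  Function.iterate_succ_apply' _ _ _

theorem Halted.run_eq {P : Program} {c : Config} (h : Halted P c) (t : ℕ) : run P c t = c := by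
  induction t with
  | zero => rfl
  | succ t ih =>
    rw [run_succ, ih]
    unfold Halted at h
    simp [step, h]

/-! Growth of the space in a single step. -/

/-- At most `N` entries of `m` are not 0, and their addresses and contents have at most `s`
bits. -/
structure BoundedMap (N s : ℕ) (m : ℕ →₀ ℕ) : Prop where
  card_le : m.support.card ≤ N
  address_lt : ∀ a ∈ m.support, a < 2 ^ s
  value_lt : ∀ a, m a < 2 ^ s

theorem BoundedMap.mono {N s N' s' : ℕ} {m : ℕ →₀ ℕ} (h : BoundedMap N s m) (hN : N ≤ N')
    (hs : s ≤ s') : BoundedMap N' s' m :=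
  have hp : 2 ^ s ≤ 2 ^ s' := Nat.pow_le_pow_right (by norm_num) hs
  ⟨h.card_le.trans hN, fun a ha => (h.address_lt a ha).trans_le hp,
    fun a => (h.value_lt a).trans_le hp⟩

theorem BoundedMap.update {N s : ℕ} {m : ℕ →₀ ℕ} (h : BoundedMap N s m) {a v : ℕ}
    (ha : a < 2 ^ (s + 1)) (hv : v < 2 ^ (s + 1)) :
    BoundedMap (N + 1) (s + 1) (m.update a v) := by
  classical
  have h' := h.mono le_rfl (Nat.le_succ s)
  have hsub : (m.update a v).support ⊆ insert a m.support := by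
    intro x hx
    rw [Finsupp.mem_support_iff, Finsupp.coe_update, Function.update_apply] at hx
    rw [Finset.mem_insert, Finsupp.mem_support_iff]
    by_cases hxa : x = a
    · exact Or.inl hxa
    · exact Or.inr (by simpa [hxa] using hx)
  refine ⟨(Finset.card_le_card hsub).trans ((Finset.card_insert_le _ _).trans ?_), ?_, ?_⟩
  · exact Nat.succ_le_succ h.card_le
  · intro x hx
    rcases Finset.mem_insert.1 (hsub hx) with rfl | hx
    · exact ha
    · exact h'.address_lt x hx
  · intro x
    rw [Finsupp.coe_update, Function.update_apply]
    split_ifs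
    · exact hv
    · exact h'.value_lt x

theorem BoundedMap.bits_le {N s : ℕ} {m : ℕ →₀ ℕ} (h : BoundedMap N s m) :
    bits m ≤ N * (2 * s) := by
  unfold bits
  refine (Finset.sum_le_card_nsmul _ _ (2 * s) fun a ha => ?_).trans ?_
  · have h1 := Nat.size_le.2 (h.address_lt a ha)
    have h2 := Nat.size_le.2 (h.value_lt a)
    omega
  · rw [smul_eq_mul]
    exact Nat.mul_le_mul_right _ h.card_le

/-- The registers and the memory are bounded. -/
structure Bounded (N s : ℕ) (c : Config) : Prop where
  reg : BoundedMap N s c.reg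
  mem : BoundedMap N s c.mem

theorem Bounded.space_le {N s : ℕ} {c : Config} (h : Bounded N s c) :
    space c ≤ N * (4 * s) := by
  have h1 := h.reg.bits_le
  have h2 := h.mem.bits_le
  unfold space
  calc _ ≤ N * (2 * s) + N * (2 * s) := Nat.add_le_add h1 h2
    _ = N * (4 * s) := by ring

/-- The instruction names only registers and constants less than `K`. -/
def Instr.Small (K : ℕ) : Instr → Prop
  | .const d k => d < K ∧ k < K
  | .add d _ _ => d < K
  | .sub d _ _ => d < K
  | .load d _ => d < K
  | _ => True

/-- Addition at most doubles the largest number, which costs one bit, and an instruction writes at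
most one cell. Only targets and constants need to be small, since reading creates no cell. -/
theorem Bounded.exec {N s : ℕ} {c : Config} (h : Bounded N s c) {i : Instr}
    (hi : i.Small (2 ^ s)) : Bounded (N + 1) (s + 1) (exec c i) := by
  have hp : 2 ^ (s + 1) = 2 ^ s + 2 ^ s := by ring
  have hr := h.reg.mono (Nat.le_succ N) (Nat.le_succ s)
  have hm := h.mem.mono (Nat.le_succ N) (Nat.le_succ s)
  cases i with
  | const d k =>
    obtain ⟨hd, hk⟩ := hi
    exact ⟨h.reg.update (by omega) (by omega), hm⟩
  | add d a b =>
    have ha := h.reg.value_lt a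
    have hb := h.reg.value_lt b
    have hd : d < 2 ^ s := hi
    exact ⟨h.reg.update (by omega) (by omega), hm⟩
  | sub d a b =>
    have ha := h.reg.value_lt a
    have hd : d < 2 ^ s := hi
    exact ⟨h.reg.update (by omega) (by omega), hm⟩
  | load d a =>
    have ha := h.mem.value_lt (c.reg a)
    have hd : d < 2 ^ s := hi
    exact ⟨h.reg.update (by omega) (by omega), hm⟩
  | store a b =>
    have ha := h.reg.value_lt a
    have hb := h.reg.value_lt b
    exact ⟨hr, h.mem.update (by omega) (by omega)⟩
  | jump l => exact ⟨hr, hm⟩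
  | jumpZero a l => exact ⟨hr, hm⟩
  | write a => exact ⟨hr, hm⟩
  | emit => exact ⟨hr, hm⟩

theorem Instr.Small.mono {K K' : ℕ} {i : Instr} (h : i.Small K) (hK : K ≤ K') : i.Small K' := by
  cases i with
  | const d k => exact ⟨h.1.trans_le hK, h.2.trans_le hK⟩
  | add d a b => exact lt_of_lt_of_le (show d < K from h) hK
  | sub d a b => exact lt_of_lt_of_le (show d < K from h) hK
  | load d a => exact lt_of_lt_of_le (show d < K from h) hK
  | _ => trivial

theorem Bounded.run {P : Program} {N s : ℕ} {c : Config} (h : Bounded N s c)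
    (hP : ∀ i ∈ P, i.Small (2 ^ s)) (t : ℕ) : Bounded (N + t) (s + t) (run P c t) := by
  induction t with
  | zero => exact h
  | succ t ih =>
    rw [run_succ, step]
    split
    · exact ⟨ih.reg.mono (Nat.le_succ _) (Nat.le_succ _), ih.mem.mono (Nat.le_succ _) (Nat.le_succ _)⟩
    · rename_i i hi
      refine ih.exec ((hP i (List.mem_of_getElem? hi)).mono ?_)
      exact Nat.pow_le_pow_right (by norm_num) (Nat.le_add_right _ _)

/-! Reaching a configuration within a given time. -/

/-- Started in `c`, the program satisfies `Q` after at most `D` steps. -/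
def Reach (P : Program) (c : Config) (D : ℕ) (Q : Config → Prop) : Prop :=
  ∃ t ≤ D, Q (run P c t)

theorem Reach.refl {P : Program} {c : Config} {D : ℕ} {Q : Config → Prop} (h : Q c) :
    Reach P c D Q :=
  ⟨0, Nat.zero_le D, h⟩

theorem Reach.trans {P : Program} {c : Config} {D₁ D₂ D : ℕ} {Q R : Config → Prop}
    (h₁ : Reach P c D₁ Q) (hD : D₁ + D₂ ≤ D) (h₂ : ∀ c', Q c' → Reach P c' D₂ R) :
    Reach P c D R := by
  obtain ⟨t₁, ht₁, hQ⟩ := h₁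
  obtain ⟨t₂, ht₂, hR⟩ := h₂ _ hQ
  exact ⟨t₁ + t₂, by omega, by rwa [run_add]⟩

theorem Reach.of_run {P : Program} {c c' : Config} {t D : ℕ} {Q : Config → Prop}
    (h₁ : run P c t = c') (h₂ : Reach P c' D Q) : Reach P c (t + D) Q := by
  obtain ⟨t₂, ht₂, hR⟩ := h₂
  exact ⟨t + t₂, by omega, by rwa [run_add, h₁]⟩

theorem Reach.mono {P : Program} {c : Config} {D D' : ℕ} {Q R : Config → Prop}
    (h : Reach P c D Q) (hD : D ≤ D') (hQ : ∀ c', Q c' → R c') : Reach P c D' R := by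
  obtain ⟨t, ht, hQ'⟩ := h
  exact ⟨t, ht.trans hD, hQ _ hQ'⟩

/-! Runs that alternate between short segments and outputs. -/

/-- The run from `c` outputs the items of `L` and halts; it consists of segments of at most `D`
steps, each of which starts in a bounded configuration and ends with an output, except for the last
one, which ends when the program halts. -/
inductive Segments (P : Program) (D N s : ℕ) : Config → List (List ℕ) → Prop
  | halt {c : Config} (hb : Bounded N s c)
      (h : Reach P c D fun c' => Halted P c' ∧ c'.buf = [] ∧ c'.out = c.out) :
      Segments P D N s c []
  | next {c : Config} {x : List ℕ} {L : List (List ℕ)} (hb : Bounded N s c) (t : ℕ) (ht : t < D)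
      (he : P[(run P c t).pc]? = some Instr.emit)
      (hout : (run P c (t + 1)).out = c.out ++ [x])
      (h : Segments P D N s (run P c (t + 1)) L) : Segments P D N s c (x :: L)

/-- The final segment may include idle steps after halting, so `T` need not be the first halting
time. The last clause is the delay in a form suited to induction: from any moment, the end or an
output follows within `D` steps. -/
theorem Segments.spec {P : Program} {D N s : ℕ} (hP : ∀ i ∈ P, i.Small (2 ^ s)) {c : Config}
    {L : List (List ℕ)} (h : Segments P D N s c L) :
    ∃ T, Halted P (run P c T) ∧ (run P c T).buf = [] ∧ (run P c T).out = c.out ++ L ∧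
      T ≤ (L.length + 1) * D ∧ (∀ t ≤ T, space (run P c t) ≤ (N + D) * (4 * (s + D))) ∧
      ∀ t < T, T ≤ t + D ∨ ∃ e, t < e ∧ e ≤ t + D ∧ OutputAt P c e := by
  have hspace : ∀ c : Config, Bounded N s c → ∀ t ≤ D,
      space (run P c t) ≤ (N + D) * (4 * (s + D)) := fun c hb t ht =>
    (hb.run hP t).space_le.trans (Nat.mul_le_mul (by omega) (by omega))
  induction h with
  | halt hb h =>
    obtain ⟨t, ht, hh, hbuf, hout⟩ := h
    refine ⟨t, hh, hbuf, by simpa using hout, by simpa using ht,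
      fun u hu => hspace _ hb u (hu.trans ht), fun u hu => Or.inl (by omega)⟩
  | @next c x L hb t ht he hout h ih =>
    obtain ⟨T, hT, hbuf, hTout, hTle, hsp, hdel⟩ := ih
    refine ⟨t + 1 + T, ?_, ?_, ?_, ?_, ?_, ?_⟩
    · rwa [run_add]
    · rwa [run_add]
    · rw [run_add, hTout, hout, List.append_assoc]
      rfl
    · rw [List.length_cons, Nat.succ_mul]
      omega
    · intro u hu
      rcases Nat.lt_or_ge u (t + 1) with h | h
      · exact hspace _ hb u (by omega)
      · obtain ⟨v, rfl⟩ := Nat.exists_eq_add_of_le h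
        rw [run_add]
        exact hsp v (by omega)
    · intro u hu
      rcases Nat.lt_or_ge u (t + 1) with h | h
      · exact Or.inr ⟨t + 1, h, by omega, t, rfl, he⟩
      · obtain ⟨v, rfl⟩ := Nat.exists_eq_add_of_le h
        rcases hdel v (by omega) with h | ⟨e, h1, h2, w, rfl, hw⟩
        · exact Or.inl (by omega)
        · exact Or.inr ⟨t + 1 + (w + 1), by omega, by omega, t + 1 + w, by omega, by
            rwa [run_add]⟩

/-- A halted machine stays as it is, so everything transfers to the first halting time. -/
theorem Segments.exists_haltsAfter {P : Program} {D N s : ℕ} (hP : ∀ i ∈ P, i.Small (2 ^ s))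
    {c : Config} {L : List (List ℕ)} (h : Segments P D N s c L) :
    ∃ T, HaltsAfter P c T ∧ (run P c T).buf = [] ∧ (run P c T).out = c.out ++ L ∧
      T ≤ (L.length + 1) * D ∧ (∀ t ≤ T, space (run P c t) ≤ (N + D) * (4 * (s + D))) ∧
      DelayAtMost P c T D := by
  classical
  obtain ⟨T', hT', hbuf, hout, hle, hsp, hdel⟩ := h.spec hP
  have hex : ∃ t, Halted P (run P c t) := ⟨T', hT'⟩
  obtain ⟨T, hT, hmin⟩ : ∃ T, Halted P (run P c T) ∧ ∀ t < T, ¬ Halted P (run P c t) :=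
    ⟨Nat.find hex, Nat.find_spec hex, fun t ht => Nat.find_min hex ht⟩
  have hTT' : T ≤ T' := by
    by_contra hlt
    exact hmin T' (not_le.1 hlt) hT'
  have heq : run P c T' = run P c T := by
    obtain ⟨v, rfl⟩ := Nat.exists_eq_add_of_le hTT'
    rw [run_add, hT.run_eq]
  rw [heq] at hbuf hout
  refine ⟨T, ⟨hT, hmin⟩, hbuf, hout, hTT'.trans hle, fun t ht => hsp t (ht.trans hTT'), ?_⟩
  intro a b ha hb hab hno
  have hbT : b ≤ T := by
    rcases hb with rfl | h | h
    · omega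
    · exact h.1
    · exact h.le
  by_contra hgt
  -- With a gap larger than `D`, the output following `a` would be an event strictly between `a` and
  -- `b`.
  rcases hdel a (by omega) with h | ⟨e, h1, h2, he⟩
  · omega
  · exact hno e h1 (by omega) (Or.inr (Or.inl ⟨by omega, he⟩))

/-! Symbolic execution with the registers given by a list. -/

/-- The registers hold the entries of `l`, and 0 beyond its length. -/
noncomputable def regs (l : List ℕ) : ℕ →₀ ℕ :=
  Finsupp.onFinset (Finset.range l.length) (fun a => l.getD a 0) (by
    intro a ha
    by_contra h
    rw [Finset.mem_range, not_lt] at h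
    exact ha (by simp [h]))

theorem regs_apply (l : List ℕ) (a : ℕ) : regs l a = l.getD a 0 := rfl

theorem update_regs {l : List ℕ} {d : ℕ} (hd : d < l.length) (v : ℕ) :
    (regs l).update d v = regs (l.set d v) := by
  ext a
  rw [Finsupp.coe_update, Function.update_apply]
  simp only [regs_apply, List.getD_eq_getElem?_getD, List.getElem?_set]
  by_cases h : a = d
  · subst h
    simp [hd]
  · simp [h, Ne.symm h]

/-- A configuration whose registers are given by a list. -/
structure State where
  pc : ℕ
  reg : List ℕ
  mem : ℕ →₀ ℕ
  buf : List ℕ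
  out : List (List ℕ)

/-- The configuration that the state describes. -/
noncomputable def State.toConfig (a : State) : Config := ⟨a.pc, regs a.reg, a.mem, a.buf, a.out⟩

/-- The effect of one instruction on a state. -/
noncomputable def State.exec (c : State) : Instr → State
  | .const d k => { c with pc := c.pc + 1, reg := c.reg.set d k }
  | .add d a b => { c with pc := c.pc + 1, reg := c.reg.set d (c.reg.getD a 0 + c.reg.getD b 0) }
  | .sub d a b => { c with pc := c.pc + 1, reg := c.reg.set d (c.reg.getD a 0 - c.reg.getD b 0) }
  | .load d a => { c with pc := c.pc + 1, reg := c.reg.set d (c.mem (c.reg.getD a 0)) }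
  | .store a b => { c with pc := c.pc + 1, mem := c.mem.update (c.reg.getD a 0) (c.reg.getD b 0) }
  | .jump l => { c with pc := l }
  | .jumpZero a l => { c with pc := if c.reg.getD a 0 = 0 then l else c.pc + 1 }
  | .write a => { c with pc := c.pc + 1, buf := c.buf ++ [c.reg.getD a 0] }
  | .emit => { c with pc := c.pc + 1, buf := [], out := c.out ++ [c.buf] }

/-- One step of the program on a state. -/
noncomputable def State.step (P : Program) (a : State) : State :=
  match P[a.pc]? with
  | none => a
  | some i => a.exec i

/-- The state after `t` steps. -/
noncomputable def State.run (P : Program) : ℕ → State → State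
  | 0, a => a
  | t + 1, a => State.run P t (a.step P)

theorem State.exec_toConfig {a : State} {i : Instr} (hi : i.Small a.reg.length) :
    RAM.exec a.toConfig i = (a.exec i).toConfig := by
  cases i with
  | const d k => simp [State.toConfig, State.exec, RAM.exec, update_regs hi.1]
  | add d x y =>
    simp [State.toConfig, State.exec, RAM.exec, update_regs (show d < _ from hi), regs_apply]
  | sub d x y =>
    simp [State.toConfig, State.exec, RAM.exec, update_regs (show d < _ from hi), regs_apply]
  | load d x =>
    simp [State.toConfig, State.exec, RAM.exec, update_regs (show d < _ from hi), regs_apply]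
  | _ => simp [State.toConfig, State.exec, RAM.exec, regs_apply]

theorem State.length_reg_step (P : Program) (a : State) :
    (a.step P).reg.length = a.reg.length := by
  unfold State.step
  split
  · rfl
  · rename_i i _
    cases i <;> simp [State.exec]

/-- Runs on states with literal register lists evaluate by `rfl`. The length condition matters:
`List.set` ignores positions beyond the end, whereas updating the registers of a `Config` does not.
-/
theorem State.run_toConfig {P : Program} {K : ℕ} (hP : ∀ i ∈ P, i.Small K) (t : ℕ) (a : State)
    (ha : a.reg.length = K) : RAM.run P a.toConfig t = (a.run P t).toConfig := by
  induction t generalizing a with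
  | zero => rfl
  | succ t ih =>
    have h : RAM.run P a.toConfig (t + 1) = RAM.run P (RAM.step P a.toConfig) t :=
      Function.iterate_succ_apply _ _ _
    rw [h, State.run, ← ih (a.step P)]
    · congr 1
      unfold RAM.step State.step
      change (match P[a.pc]? with | none => _ | some i => _) = _
      split
      · rfl
      · rename_i i hi
        exact State.exec_toConfig (ha ▸ hP i (List.mem_of_getElem? hi))
    · rw [State.length_reg_step, ha]

theorem regs_bounded {l : List ℕ} {s : ℕ} (h : ∀ v ∈ l, v < 2 ^ s) (hl : l.length ≤ 2 ^ s) :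
    BoundedMap l.length s (regs l) := by
  have hsub : (regs l).support ⊆ Finset.range l.length := Finsupp.support_onFinset_subset
  refine ⟨?_, fun a ha => ?_, fun a => ?_⟩
  · simpa using Finset.card_le_card hsub
  · exact (Finset.mem_range.1 (hsub ha)).trans_le hl
  · rw [regs_apply, List.getD_eq_getElem?_getD]
    rcases Nat.lt_or_ge a l.length with h' | h'
    · simpa [h'] using h _ (List.getElem_mem h')
    · simp [h']

end RAM

/-! ### Marks on the vertices that represent a packing. -/

section Marks

variable {V : Type*}

open Classical in
/-- The number by which the memory represents `packingFun G S v`: 3 on `S`, 1 on the other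
neighbors of `S`, 0 elsewhere. -/
noncomputable def packingMark (G : SimpleGraph V) (S : Finset V) (v : V) : ℕ :=
  if v ∈ S then 3 else if ∃ u ∈ S, G.Adj u v then 1 else 0

/-- The value that a mark represents. -/
def decodeMark (x : ℕ) : ℕ := x - 1 + (1 - x)

/-- The marks 3, 1, 0 stand for the values 2, 0, 1. With this code, memory that is still zero
represents the empty packing, and truncated subtraction suffices for decoding. -/
theorem decodeMark_packingMark (G : SimpleGraph V) (S : Finset V) (v : V) :
    decodeMark (packingMark G S v) = (packingFun G S v : ℕ) := by
  unfold packingMark packingFun decodeMark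
  split_ifs <;> simp

theorem packingMark_le (G : SimpleGraph V) (S : Finset V) (v : V) : packingMark G S v ≤ 3 := by
  unfold packingMark
  split_ifs <;> simp

theorem packingMark_eq_zero {G : SimpleGraph V} {S : Finset V} {v : V} :
    packingMark G S v = 0 ↔ ∀ u ∈ S, ¬ InClosedNbhd G u v := by
  unfold packingMark InClosedNbhd
  split_ifs with h1 h2
  · simp only [false_iff, not_forall, not_not]
    exact ⟨v, h1, Or.inl rfl⟩
  · simp only [false_iff, not_forall, not_not]
    obtain ⟨u, hu, huv⟩ := h2
    exact ⟨u, hu, Or.inr huv⟩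
  · simp only [true_iff]
    rintro u hu (rfl | huv)
    · exact h1 hu
    · exact h2 ⟨u, hu, huv⟩

/-- A nonzero mark means membership in the closed neighborhood of an element of `S`; so whether `i`
can be added is decided by the marks on its closed neighborhood. -/
theorem isPacking_insert_iff [DecidableEq V] {G : SimpleGraph V} {S : Finset V} {i : V}
    (hS : IsPacking G S) (hi : i ∉ S) :
    IsPacking G (insert i S) ↔ ∀ w, InClosedNbhd G i w → packingMark G S w = 0 := by
  constructor
  · intro h w hw
    rw [packingMark_eq_zero]
    intro u hu huw
    have := h w u (Finset.mem_insert_of_mem hu) i (Finset.mem_insert_self _ _) huw hw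
    exact hi (this ▸ hu)
  · intro h w u hu v hv huw hvw
    rcases Finset.mem_insert.1 hu with hui | huS <;> rcases Finset.mem_insert.1 hv with hvi | hvS
    · rw [hui, hvi]
    · exact absurd hvw (packingMark_eq_zero.1 (h w (hui ▸ huw)) v hvS)
    · exact absurd huw (packingMark_eq_zero.1 (h w (hvi ▸ hvw)) u huS)
    · exact hS w u huS v hvS huw hvw

open Classical in
-- No neighbor of `i` belongs to the packing, so writing 1 on the neighbors overwrites no 3.
theorem packingMark_insert [DecidableEq V] {G : SimpleGraph V} {S : Finset V} {i : V}
    (h : IsPacking G (insert i S)) :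
    packingMark G (insert i S) =
      fun v => if G.Adj i v then 1 else Function.update (packingMark G S) i 3 v := by
  funext v
  by_cases hiv : G.Adj i v
  · have hv : v ∉ insert i S := fun hv =>
      hiv.ne (h v i (Finset.mem_insert_self _ _) v hv (Or.inr hiv) (Or.inl rfl))
    have hex : ∃ u ∈ insert i S, G.Adj u v := ⟨i, Finset.mem_insert_self _ _, hiv⟩
    rw [if_pos hiv, packingMark, if_neg hv, if_pos hex]
  · rw [if_neg hiv, Function.update_apply]
    by_cases hvi : v = i
    · subst hvi
      simp [packingMark]
    · simp [packingMark, hvi, hiv]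

open Classical in
-- Before `i` was added, all marks on its closed neighborhood were 0; so removing `i` means writing
-- zeros there, without recomputing the other marks.
theorem packingMark_of_insert [DecidableEq V] {G : SimpleGraph V} {S : Finset V} {i : V}
    (h : IsPacking G (insert i S)) (hi : i ∉ S) :
    packingMark G S =
      fun v => if G.Adj i v then 0 else Function.update (packingMark G (insert i S)) i 0 v := by
  have h0 := (isPacking_insert_iff (h.subset (Finset.subset_insert i S)) hi).1 h
  funext v
  by_cases hiv : G.Adj i v
  · rw [if_pos hiv, h0 v (Or.inr hiv)]
  · rw [if_neg hiv, Function.update_apply]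
    by_cases hvi : v = i
    · subst hvi
      rw [if_pos rfl, h0 v (Or.inl rfl)]
    · simp [packingMark, hvi, hiv]

end Marks

/-! ### The adjacency matrix and the marks in memory. -/

section MemoryLayout

variable {n : ℕ}

open Classical in
/-- The memory holds the adjacency matrix of `G`, followed by the marks `g`. -/
structure Holds (G : SimpleGraph (Fin n)) (g : Fin n → ℕ) (m : ℕ →₀ ℕ) : Prop where
  adj : ∀ i j : Fin n, m (i * n + j) = if G.Adj i j then 1 else 0
  mark : ∀ v : Fin n, m (n * n + v) = g v
  rest : ∀ a, n * n + n ≤ a → m a = 0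

theorem row_add_lt (i j : Fin n) : (i : ℕ) * n + j < n * n := by
  have hi : ((i : ℕ) + 1) * n ≤ n * n := Nat.mul_le_mul_right n i.isLt
  have hj := j.isLt
  rw [Nat.add_mul, one_mul] at hi
  omega

open Classical in
theorem holds_adjacencyMemory (G : SimpleGraph (Fin n)) :
    Holds G (packingMark G ∅) (adjacencyMemory G) := by
  -- Quotient and remainder modulo `n` recover row and column from the address.
  have hrow : ∀ i j i' j' : Fin n, (i : ℕ) * n + j = i' * n + j' → i = i' ∧ j = j' := by
    intro i j i' j' h
    have hn : 0 < n := i.pos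
    have h1 := congrArg (· / n) h
    have h2 := congrArg (· % n) h
    simp only [mul_comm _ n, Nat.mul_add_div hn, Nat.div_eq_of_lt j.isLt, Nat.div_eq_of_lt j'.isLt, Nat.mul_add_mod, Nat.mod_eq_of_lt j.isLt,
      Nat.mod_eq_of_lt j'.isLt, add_zero] at h1 h2
    exact ⟨Fin.ext h1, Fin.ext h2⟩
  have hzero : ∀ a, n * n ≤ a → adjacencyMemory G a = 0 := by
    intro a ha
    refine if_neg ?_
    rintro ⟨i, j, -, rfl⟩
    exact absurd (row_add_lt i j) (not_lt.2 ha)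
  refine ⟨fun i j => ?_, fun v => ?_, fun a ha => hzero a (by omega)⟩
  · refine if_congr ⟨?_, fun h => ⟨i, j, h, rfl⟩⟩ rfl rfl
    rintro ⟨i', j', h, he⟩
    obtain ⟨rfl, rfl⟩ := hrow _ _ _ _ he
    exact h
  · rw [hzero _ (Nat.le_add_right _ _)]
    simp [packingMark]

theorem Holds.update {G : SimpleGraph (Fin n)} {g : Fin n → ℕ} {m : ℕ →₀ ℕ} (h : Holds G g m)
    (v : Fin n) (x : ℕ) : Holds G (Function.update g v x) (m.update (n * n + v) x) := by
  refine ⟨fun i j => ?_, fun w => ?_, fun a ha => ?_⟩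
  · have := row_add_lt i j
    rw [Finsupp.coe_update, Function.update_of_ne (by omega), h.adj]
  · rw [Finsupp.coe_update, Function.update_apply, Function.update_apply, h.mark]
    simp [Fin.ext_iff]
  · have := v.isLt
    rw [Finsupp.coe_update, Function.update_of_ne (by omega), h.rest a ha]

theorem Holds.boundedMap {G : SimpleGraph (Fin n)} {g : Fin n → ℕ} {m : ℕ →₀ ℕ} (h : Holds G g m)
    (hg : ∀ v, g v ≤ 3) : RAM.BoundedMap (n * n + n + 10) (n * n + n + 10) m := by
  have hsub : m.support ⊆ Finset.range (n * n + n) := by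
    intro a ha
    rw [Finset.mem_range]
    by_contra hlt
    exact Finsupp.mem_support_iff.1 ha (h.rest a (not_lt.1 hlt))
  refine ⟨?_, fun a ha => ?_, fun a => ?_⟩
  · have := Finset.card_le_card hsub
    rw [Finset.card_range] at this
    omega
  · have := Finset.mem_range.1 (hsub ha)
    exact lt_trans (by omega) Nat.lt_two_pow_self
  · have h3 : m a ≤ 3 := by
      rcases Nat.lt_or_ge a (n * n) with h1 | h1
      · have hn : 0 < n := Nat.pos_of_ne_zero (by rintro rfl; simp at h1)
        have := h.adj ⟨a / n, Nat.div_lt_of_lt_mul h1⟩ ⟨a % n, Nat.mod_lt a hn⟩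
        rw [Nat.div_add_mod' a n] at this
        rw [this]
        split_ifs <;> simp
      · rcases Nat.lt_or_ge a (n * n + n) with h2 | h2
        · have := h.mark ⟨a - n * n, by omega⟩
          rw [Nat.add_sub_cancel' h1] at this
          rw [this]
          exact hg _
        · simp [h.rest a h2]
    exact lt_trans (by omega : m a < n * n + n + 10) Nat.lt_two_pow_self

end MemoryLayout

/-! ### The enumeration program and rules for its execution. -/

open RAM

/-- The program.  Registers: 0 the order `n`, 1 the address `n * n` of the marks, 2 a vertex `i`,
3 the address `i * n` of its row, 4 the vertex of the inner loops, 5 the address of the mark of `i`,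
6 scratch, 7 the new mark for the neighbors of `i`, 8 one, 9 zero. -/
def enumProgram : Program :=
  [.const 8 1, .add 4 0 9,
   -- instruction 2: compute `n * n`
   .jumpZero 4 6, .add 1 1 0, .sub 4 4 8, .jump 2,
   -- instruction 6: output the function that the marks represent
   .sub 5 0 4, .jumpZero 5 16, .add 5 1 4, .load 5 5, .sub 6 8 5, .sub 5 5 8, .add 5 5 6,
   .write 5, .add 4 4 8, .jump 6, .const 4 0, .const 6 0, .emit,
   -- instruction 19: look for the last vertex that can be added to the part of the set before it
   .add 2 0 9, .add 3 1 9,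
   .jumpZero 2 63, .sub 2 2 8, .sub 3 3 0, .add 5 1 2, .load 6 5, .jumpZero 6 32, .sub 6 6 8,
   .jumpZero 6 21, .store 5 9, .const 7 0, .jump 47,
   -- instruction 32: check that no neighbor of `i` is marked
   .const 4 0, .sub 6 0 4, .jumpZero 6 44, .add 6 3 4, .load 6 6, .jumpZero 6 42, .add 6 1 4,
   .load 6 6, .jumpZero 6 42, .jump 21, .add 4 4 8, .jump 33,
   .const 6 3, .store 5 6, .const 7 1,
   -- instruction 47: change the marks of the neighbors of `i`
   .const 4 0, .sub 6 0 4, .jumpZero 6 57, .add 6 3 4, .load 6 6, .jumpZero 6 55, .add 6 1 4,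
   .store 6 7, .add 4 4 8, .jump 48,
   .jumpZero 7 21, .const 2 0, .const 3 0, .const 4 0, .const 7 0, .jump 6]

theorem enumProgram_small : ∀ i ∈ enumProgram, i.Small 10 := by
  simp [enumProgram, Instr.Small]

namespace RAM

/-- Spends `t` steps of the time budget on a stretch of code whose effect `h` is checked by
evaluation. Conditional jumps on symbolic values do not evaluate and have their own rules. -/
theorem Reach.block {pc pc' : ℕ} {l l' : List ℕ} {m m' : ℕ →₀ ℕ} {buf buf' : List ℕ}
    {out out' : List (List ℕ)} {D : ℕ} {Q : Config → Prop} (t : ℕ)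
    (h : State.run enumProgram t ⟨pc, l, m, buf, out⟩ = ⟨pc', l', m', buf', out'⟩)
    (hl : l.length = 10) (ht : t ≤ D)
    (h' : Reach enumProgram (State.toConfig ⟨pc', l', m', buf', out'⟩) (D - t) Q) :
    Reach enumProgram (State.toConfig ⟨pc, l, m, buf, out⟩) D Q := by
  have := h'.of_run (by
    rw [State.run_toConfig enumProgram_small t ⟨pc, l, m, buf, out⟩ hl, h])
  rwa [Nat.add_sub_cancel' ht] at this

theorem Reach.goto {pc : ℕ} {l : List ℕ} {m : ℕ →₀ ℕ} {buf : List ℕ} {out : List (List ℕ)} {D : ℕ}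
    {Q : Config → Prop} (t pc' : ℕ) (l' : List ℕ)
    (h : State.run enumProgram t ⟨pc, l, m, buf, out⟩ = ⟨pc', l', m, buf, out⟩)
    (hl : l.length = 10) (ht : t ≤ D)
    (h' : Reach enumProgram (State.toConfig ⟨pc', l', m, buf, out⟩) (D - t) Q) :
    Reach enumProgram (State.toConfig ⟨pc, l, m, buf, out⟩) D Q :=
  Reach.block t h hl ht h'

theorem Reach.jump_zero {pc pc' a : ℕ} {l : List ℕ} {m : ℕ →₀ ℕ} {buf : List ℕ}
    {out : List (List ℕ)} {D : ℕ} {Q : Config → Prop}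
    (h : enumProgram[pc]? = some (.jumpZero a pc')) (hl : l.length = 10) (ha : l.getD a 0 = 0)
    (hD : 1 ≤ D)
    (h' : Reach enumProgram (State.toConfig ⟨pc', l, m, buf, out⟩) (D - 1) Q) :
    Reach enumProgram (State.toConfig ⟨pc, l, m, buf, out⟩) D Q := by
  refine Reach.block 1 ?_ hl hD h'
  simp only [State.run, State.step, h, State.exec, ha, if_true]

theorem Reach.jump_nonzero {pc pc' a : ℕ} {l : List ℕ} {m : ℕ →₀ ℕ} {buf : List ℕ}
    {out : List (List ℕ)} {D : ℕ} {Q : Config → Prop}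
    (h : enumProgram[pc]? = some (.jumpZero a pc')) (hl : l.length = 10) (ha : l.getD a 0 ≠ 0)
    (hD : 1 ≤ D)
    (h' : Reach enumProgram (State.toConfig ⟨pc + 1, l, m, buf, out⟩) (D - 1) Q) :
    Reach enumProgram (State.toConfig ⟨pc, l, m, buf, out⟩) D Q := by
  refine Reach.block 1 ?_ hl hD h'
  simp only [State.run, State.step, h, State.exec, if_neg ha]

end RAM

/-! ### Correctness and running time of the inner loops. -/

section Loops

variable {n : ℕ} {G : SimpleGraph (Fin n)}

theorem reach_square (n k x : ℕ) (m : ℕ →₀ ℕ) :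
    Reach enumProgram (State.toConfig ⟨2, [n, x, 0, 0, k, 0, 0, 0, 1, 0], m, [], []⟩)
      (4 * k + 1)
      fun c => c = State.toConfig ⟨6, [n, x + k * n, 0, 0, 0, 0, 0, 0, 1, 0], m, [], []⟩ := by
  induction k generalizing x with
  | zero =>
    refine Reach.jump_zero rfl rfl rfl (by omega) (Reach.refl ?_)
    rw [zero_mul, add_zero]
  | succ k ih =>
    refine Reach.jump_nonzero rfl rfl (Nat.succ_ne_zero k) (by omega) ?_
    refine Reach.goto 3 2 [n, x + n, 0, 0, k, 0, 0, 0, 1, 0] rfl rfl (by omega) ?_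
    refine (ih (x + n)).mono (by omega) fun c hc => ?_
    rw [hc, Nat.succ_mul, add_assoc, Nat.add_comm n]

/-- Each round takes 10 steps and the exit takes 4. The contents `x`, `y` of the scratch registers
are arbitrary, which lets the induction pass over leftovers. -/
theorem reach_output {g : Fin n → ℕ} {m : ℕ →₀ ℕ} (hm : Holds G g m) (k w x y : ℕ)
    (hk : w + k = n) (buf : List ℕ) (out : List (List ℕ)) :
    Reach enumProgram (State.toConfig ⟨6, [n, n * n, 0, 0, w, x, y, 0, 1, 0], m, buf, out⟩)
      (10 * k + 4)
      fun c => c = State.toConfig ⟨18, [n, n * n, 0, 0, 0, 0, 0, 0, 1, 0], m,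
        buf ++ (List.ofFn fun v => decodeMark (g v)).drop w, out⟩ := by
  induction k generalizing w x y buf with
  | zero =>
    obtain rfl : w = n := hk
    refine Reach.goto 1 7 [w, w * w, 0, 0, w, w - w, y, 0, 1, 0] rfl rfl (by omega) ?_
    rw [Nat.sub_self]
    refine Reach.jump_zero rfl rfl rfl (by omega) ?_
    refine Reach.goto 2 18 [w, w * w, 0, 0, 0, 0, 0, 0, 1, 0] rfl rfl (by omega) ?_
    refine Reach.refl ?_
    rw [List.drop_eq_nil_of_le (by simp), List.append_nil]
  | succ k ih =>
    have hw : w < n := by omega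
    refine Reach.goto 1 7 [n, n * n, 0, 0, w, n - w, y, 0, 1, 0] rfl rfl (by omega) ?_
    refine Reach.jump_nonzero rfl rfl (Nat.sub_ne_zero_of_lt hw) (by omega) ?_
    refine Reach.block (pc' := 6) (l' := [n, n * n, 0, 0, w + 1, decodeMark (m (n * n + w)),
      1 - m (n * n + w), 0, 1, 0]) (m' := m) (buf' := buf ++ [decodeMark (m (n * n + w))])
      (out' := out) 8 rfl rfl (by omega) ?_
    refine (ih (w + 1) _ _ (by omega) _).mono (by omega) fun c hc => ?_
    rw [hc, List.append_assoc]
    congr 3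
    rw [List.drop_eq_getElem_cons (i := w) (by simpa using hw), List.getElem_ofFn]
    have := hm.mark ⟨w, hw⟩
    rw [← this]
    rfl

theorem reach_check {g : Fin n → ℕ} {m : ℕ →₀ ℕ} (hm : Holds G g m) (i : Fin n) (k w x y z : ℕ)
    (hk : w + k = n) (out : List (List ℕ)) :
    Reach enumProgram
      (State.toConfig ⟨33, [n, n * n, i, i * n, w, x, y, z, 1, 0], m, [], out⟩) (10 * k + 2)
      fun c => ∃ w' y', (c = State.toConfig
          ⟨44, [n, n * n, i, i * n, w', x, y', z, 1, 0], m, [], out⟩ ∧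
            ∀ v : Fin n, w ≤ v → G.Adj i v → g v = 0) ∨
        (c = State.toConfig ⟨21, [n, n * n, i, i * n, w', x, y', z, 1, 0], m, [], out⟩ ∧
            ∃ v, G.Adj i v ∧ g v ≠ 0) := by
  induction k generalizing w y with
  | zero =>
    obtain rfl : w = n := hk
    refine Reach.goto 1 34 [w, w * w, i, i * w, w, x, w - w, z, 1, 0] rfl rfl (by omega) ?_
    rw [Nat.sub_self]
    refine Reach.jump_zero rfl rfl rfl (by omega) (Reach.refl ?_)
    exact ⟨_, _, Or.inl ⟨rfl, fun v hv => absurd v.isLt (not_lt.2 hv)⟩⟩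
  | succ k ih =>
    have hw : w < n := by omega
    have hadj := hm.adj i ⟨w, hw⟩
    have hmark := hm.mark ⟨w, hw⟩
    -- Both ways of passing the test at `w` meet here. The remaining budget `10 * (k + 1) - 6 = 10 *
    -- k + 4` covers two instructions and the rest of the loop.
    have hnext : ∀ y' D, 10 * (k + 1) - 6 ≤ D → (G.Adj i ⟨w, hw⟩ → g ⟨w, hw⟩ = 0) →
        Reach enumProgram
          (State.toConfig ⟨42, [n, n * n, i, i * n, w, x, y', z, 1, 0], m, [], out⟩) D
          fun c => ∃ w' y', (c = State.toConfig
            ⟨44, [n, n * n, i, i * n, w', x, y', z, 1, 0], m, [], out⟩ ∧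
              ∀ v : Fin n, w ≤ v → G.Adj i v → g v = 0) ∨
          (c = State.toConfig ⟨21, [n, n * n, i, i * n, w', x, y', z, 1, 0], m, [], out⟩ ∧
              ∃ v, G.Adj i v ∧ g v ≠ 0) := by
      intro y' D hD h0
      refine Reach.goto 2 33 [n, n * n, i, i * n, w + 1, x, y', z, 1, 0] rfl rfl
        (by omega) ?_
      refine (ih (w + 1) y' (by omega)).mono (by omega) ?_
      rintro c ⟨w', y'', ⟨hc, h⟩ | ⟨hc, h⟩⟩
      · refine ⟨w', y'', Or.inl ⟨hc, fun v hv hadj => ?_⟩⟩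
        rcases hv.eq_or_lt with hv | hv
        · obtain rfl : (⟨w, hw⟩ : Fin n) = v := Fin.ext hv
          exact h0 hadj
        · exact h v hv hadj
      · exact ⟨w', y'', Or.inr ⟨hc, h⟩⟩
    refine Reach.goto 1 34 [n, n * n, i, i * n, w, x, n - w, z, 1, 0] rfl rfl (by omega) ?_
    refine Reach.jump_nonzero rfl rfl (Nat.sub_ne_zero_of_lt hw) (by omega) ?_
    refine Reach.goto 2 37 [n, n * n, i, i * n, w, x, m (i * n + w), z, 1, 0] rfl rfl
      (by omega) ?_
    by_cases hiw : G.Adj i ⟨w, hw⟩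
    · rw [if_pos hiw] at hadj
      refine Reach.jump_nonzero rfl rfl (ne_of_eq_of_ne hadj one_ne_zero) (by omega) ?_
      refine Reach.goto 2 40 [n, n * n, i, i * n, w, x, m (n * n + w), z, 1, 0] rfl rfl
        (by omega) ?_
      by_cases hg : g ⟨w, hw⟩ = 0
      · refine Reach.jump_zero rfl rfl (hmark.trans hg) (by omega) ?_
        exact hnext _ _ (by omega) fun _ => hg
      · refine Reach.jump_nonzero rfl rfl (ne_of_eq_of_ne hmark hg) (by omega) ?_
        refine Reach.goto 1 21 _ rfl rfl (by omega) (Reach.refl ?_)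
        exact ⟨_, _, Or.inr ⟨rfl, _, hiw, hg⟩⟩
    · rw [if_neg hiw] at hadj
      refine Reach.jump_zero rfl rfl hadj (by omega) ?_
      exact hnext _ _ (by omega) fun h => absurd h hiw

open Classical in
theorem reach_mark {g : Fin n → ℕ} {m : ℕ →₀ ℕ} (hm : Holds G g m) (i : Fin n) (k w x y z : ℕ)
    (hk : w + k = n) (out : List (List ℕ)) :
    Reach enumProgram
      (State.toConfig ⟨48, [n, n * n, i, i * n, w, x, y, z, 1, 0], m, [], out⟩) (10 * k + 2)
      fun c => ∃ m' w' y',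
        c = State.toConfig ⟨57, [n, n * n, i, i * n, w', x, y', z, 1, 0], m', [], out⟩ ∧
        Holds G (fun v => if w ≤ (v : ℕ) ∧ G.Adj i v then z else g v) m' := by
  -- The marks `g` are generalized as well, because each round may change one of them.
  induction k generalizing w y m g with
  | zero =>
    obtain rfl : w = n := hk
    refine Reach.goto 1 49 [w, w * w, i, i * w, w, x, w - w, z, 1, 0] rfl rfl (by omega) ?_
    rw [Nat.sub_self]
    refine Reach.jump_zero rfl rfl rfl (by omega) (Reach.refl ?_)
    refine ⟨_, _, _, rfl, ?_⟩
    convert hm using 2 with v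
    exact if_neg fun h => absurd v.isLt (not_lt.2 h.1)
  | succ k ih =>
    have hw : w < n := by omega
    have hadj := hm.adj i ⟨w, hw⟩
    refine Reach.goto 1 49 [n, n * n, i, i * n, w, x, n - w, z, 1, 0] rfl rfl (by omega) ?_
    refine Reach.jump_nonzero rfl rfl (Nat.sub_ne_zero_of_lt hw) (by omega) ?_
    refine Reach.goto 2 52 [n, n * n, i, i * n, w, x, m (i * n + w), z, 1, 0] rfl rfl
      (by omega) ?_
    by_cases hiw : G.Adj i ⟨w, hw⟩
    · rw [if_pos hiw] at hadj
      refine Reach.jump_nonzero rfl rfl (ne_of_eq_of_ne hadj one_ne_zero) (by omega) ?_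
      refine Reach.block (pc' := 48) (l' := [n, n * n, i, i * n, w + 1, x, n * n + w, z, 1, 0])
        (m' := m.update (n * n + w) z) (buf' := []) (out' := out) 4 rfl rfl (by omega) ?_
      refine (ih (hm.update ⟨w, hw⟩ z) (w + 1) _ (by omega)).mono (by omega) ?_
      rintro c ⟨m', w', y', hc, hm'⟩
      refine ⟨m', w', y', hc, ?_⟩
      convert hm' using 2 with v
      rw [Function.update_apply]
      by_cases hv : v = ⟨w, hw⟩
      · subst hv
        simp [hiw]
      · have hv' : (v : ℕ) ≠ w := fun h => hv (Fin.ext h)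
        have : w ≤ (v : ℕ) ↔ w + 1 ≤ (v : ℕ) := by omega
        simp [hv, this]
    · rw [if_neg hiw] at hadj
      refine Reach.jump_zero rfl rfl hadj (by omega) ?_
      refine Reach.goto 2 48 [n, n * n, i, i * n, w + 1, x, m (i * n + w), z, 1, 0] rfl rfl
        (by omega) ?_
      refine (ih hm (w + 1) _ (by omega)).mono (by omega) ?_
      rintro c ⟨m', w', y', hc, hm'⟩
      refine ⟨m', w', y', hc, ?_⟩
      convert hm' using 2 with v
      by_cases hv : v = ⟨w, hw⟩
      · subst hv
        simp [hiw]
      · have hv' : (v : ℕ) ≠ w := fun h => hv (Fin.ext h)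
        have : w ≤ (v : ℕ) ↔ w + 1 ≤ (v : ℕ) := by omega
        simp [this]

end Loops

/-! ### The search for the lexicographic successor. -/

section Search

variable {n : ℕ} {G : SimpleGraph (Fin n)}

theorem below_succ_of_mem {S : Finset (Fin n)} {i : Fin n} (hi : i ∈ S) :
    below S (i + 1) = insert i (below S i) := by
  ext j
  rw [Finset.mem_insert, mem_below, mem_below, Nat.lt_succ_iff, Nat.le_iff_lt_or_eq, Fin.ext_iff]
  constructor
  · tauto
  · rintro (h | h)
    · exact ⟨Fin.ext h ▸ hi, Or.inr h⟩
    · exact ⟨h.1, Or.inl h.2⟩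

theorem below_succ_of_notMem {S : Finset (Fin n)} {i : Fin n} (hi : i ∉ S) :
    below S (i + 1) = below S i := by
  ext j
  rw [mem_below, mem_below, Nat.lt_succ_iff, Nat.le_iff_lt_or_eq]
  constructor
  · rintro ⟨hj, h | h⟩
    · exact ⟨hj, h⟩
    · exact absurd (Fin.ext h ▸ hj) hi
  · tauto

theorem notMem_below (S : Finset (Fin n)) (i : Fin n) : i ∉ below S i := by
  simp [mem_below]

/-- The outcome of the search for the successor of the packing `S`: either there is none, and the
program halts, or the memory represents the successor, and the program is about to output it. -/
def SearchResult (G : SimpleGraph (Fin n)) (S : Finset (Fin n)) (out : List (List ℕ))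
    (c : Config) : Prop :=
  (NoExtensionFrom G S 0 ∧ Halted enumProgram c ∧ c.buf = [] ∧ c.out = out) ∨
    ∃ (i : Fin n) (m : ℕ →₀ ℕ) (x y : ℕ), NoExtensionFrom G S (i + 1) ∧ i ∉ S ∧
      IsPacking G (insert i (below S i)) ∧ Holds G (packingMark G (insert i (below S i))) m ∧
      c = State.toConfig ⟨6, [n, n * n, 0, 0, 0, x, y, 0, 1, 0], m, [], out⟩

/-- The invariant of the backward scan: no vertex from `k` on gives an extension, and the marks are
those of `below S k`. Each vertex costs at most one check and one marking loop, of `10 * n + 2`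
steps each, plus constant overhead. -/
theorem reach_search {S : Finset (Fin n)} (hS : IsPacking G S) (k : ℕ) (hk : k ≤ n)
    (hext : NoExtensionFrom G S k) (w x y z : ℕ) {m : ℕ →₀ ℕ}
    (hm : Holds G (packingMark G (below S k)) m) (out : List (List ℕ)) :
    Reach enumProgram
      (State.toConfig ⟨21, [n, n * n, k, k * n, w, x, y, z, 1, 0], m, [], out⟩)
      ((20 * n + 40) * k + 1) (SearchResult G S out) := by
  classical
  induction k generalizing w x y z m with
  | zero =>
    refine Reach.jump_zero rfl rfl rfl (by omega) (Reach.refl ?_)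
    exact Or.inl ⟨hext, rfl, rfl, rfl⟩
  | succ k ih =>
    have hmul : (20 * n + 40) * (k + 1) = (20 * n + 40) * k + (20 * n + 40) := Nat.mul_succ _ _
    rw [hmul]
    obtain ⟨i, rfl⟩ : ∃ i : Fin n, (i : ℕ) = k := ⟨⟨k, hk⟩, rfl⟩
    have hb : ((i : ℕ) + 1) * n - n = i * n := by rw [Nat.succ_mul, Nat.add_sub_cancel]
    have hmi := hm.mark i
    refine Reach.jump_nonzero rfl rfl (Nat.succ_ne_zero i) (by omega) ?_
    refine Reach.goto 4 26 [n, n * n, i, ((i : ℕ) + 1) * n - n, w, n * n + i, m (n * n + i), z, 1, 0]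
      rfl rfl (by omega) ?_
    rw [hb]
    have hpb : IsPacking G (below S i) := hS.subset (Finset.filter_subset _ _)
    by_cases hiS : i ∈ S
    · have hsucc := below_succ_of_mem hiS
      have hp : IsPacking G (insert i (below S i)) := by
        rw [← hsucc]
        exact hS.subset (Finset.filter_subset _ _)
      -- The mark 3 remains nonzero after subtracting 1, which distinguishes members from their
      -- neighbors.
      have h3 : m (n * n + i) = 3 := by
        rw [hmi, hsucc]
        simp [packingMark]
      rw [h3]
      refine Reach.jump_nonzero rfl rfl (Nat.succ_ne_zero _) (by omega) ?_
      refine Reach.goto 1 28 [n, n * n, i, i * n, w, n * n + i, 2, z, 1, 0] rfl rfl (by omega) ?_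
      refine Reach.jump_nonzero rfl rfl (Nat.succ_ne_zero _) (by omega) ?_
      refine Reach.block (pc' := 48) (l' := [n, n * n, i, i * n, 0, n * n + i, 2, 0, 1, 0])
        (m' := m.update (n * n + i) 0) (buf' := []) (out' := out) 4 rfl rfl (by omega) ?_
      refine (reach_mark (hm.update i 0) i n 0 _ _ 0 (zero_add n) out).trans
        (D₂ := (20 * n + 40) * i + 2) (by omega) ?_
      rintro c ⟨m', w', y', rfl, hm'⟩
      -- Register 7 also serves as a flag: it is 0 after a removal, and the scan goes on; it is 1
      -- after an insertion, and the output follows.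
      refine Reach.jump_zero rfl rfl rfl (by omega) ?_
      refine (ih i.isLt.le ?_ _ _ _ _ ?_).mono (by omega) fun _ h => h
      · intro j hj hjS
        rcases hj.eq_or_lt with hj | hj
        · exact absurd (Fin.ext hj ▸ hiS) hjS
        · exact hext j hj hjS
      · rw [packingMark_of_insert hp (notMem_below S i), ← hsucc]
        simpa using hm'
    · have hsucc := below_succ_of_notMem hiS
      rw [hsucc] at hm hmi
      have hiff := isPacking_insert_iff hpb (notMem_below S i)
      have hfail : ∀ w' x' y' z' D, (20 * n + 40) * i + 1 ≤ D →
          ¬ IsPacking G (insert i (below S i)) → Reach enumProgram (State.toConfig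
            ⟨21, [n, n * n, i, i * n, w', x', y', z', 1, 0], m, [], out⟩) D
            (SearchResult G S out) := by
        intro w' x' y' z' D hD hno
        refine (ih i.isLt.le ?_ w' x' y' z' hm).mono hD fun _ h => h
        intro j hj hjS
        rcases hj.eq_or_lt with hj | hj
        · obtain rfl := Fin.ext hj
          exact hno
        · exact hext j hj hjS
      by_cases hzero : packingMark G (below S i) i = 0
      · refine Reach.jump_zero rfl rfl (hmi.trans hzero) (by omega) ?_
        refine Reach.goto 1 33 [n, n * n, i, i * n, 0, n * n + i, m (n * n + i), z, 1, 0]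
          rfl rfl (by omega) ?_
        refine (reach_check hm i n 0 _ _ _ (zero_add n) out).trans
          (D₂ := (20 * n + 40) * i + 10 * n + 20) (by omega) ?_
        rintro c ⟨w', y', ⟨rfl, h⟩ | ⟨rfl, v, hiv, hv⟩⟩
        · have hp : IsPacking G (insert i (below S i)) := by
            rw [hiff]
            rintro v (rfl | hiv)
            · exact hzero
            · exact h v (Nat.zero_le _) hiv
          refine Reach.block (pc' := 48) (l' := [n, n * n, i, i * n, 0, n * n + i, 3, 1, 1, 0])
            (m' := m.update (n * n + i) 3) (buf' := []) (out' := out) 4 rfl rfl (by omega) ?_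
          refine (reach_mark (hm.update i 3) i n 0 _ _ 1 (zero_add n) out).trans
            (D₂ := 6) (by omega) ?_
          rintro c ⟨m', w', y', rfl, hm'⟩
          refine Reach.jump_nonzero rfl rfl one_ne_zero (by omega) ?_
          refine Reach.goto 5 6 [n, n * n, 0, 0, 0, n * n + i, y', 0, 1, 0] rfl rfl (by omega) ?_
          refine Reach.refl (Or.inr ⟨i, m', _, _, hext, hiS, hp, ?_, rfl⟩)
          rw [packingMark_insert hp]
          simpa using hm'
        · exact hfail _ _ _ _ _ (by omega) fun hp => hv (hiff.1 hp v (Or.inr hiv))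
      · refine Reach.jump_nonzero rfl rfl (ne_of_eq_of_ne hmi hzero) (by omega) ?_
        -- Since `i` is not in `below S i`, a nonzero mark must be 1: `i` is adjacent to an element
        -- and cannot be added.
        have hone : m (n * n + i) = 1 := by
          rw [hmi]
          revert hzero
          unfold packingMark
          rw [if_neg (notMem_below S i)]
          split_ifs <;> simp
        refine Reach.goto 1 28 [n, n * n, i, i * n, w, n * n + i, m (n * n + i) - 1, z, 1, 0]
          rfl rfl (by omega) ?_
        rw [hone]
        refine Reach.jump_zero rfl rfl rfl (by omega) ?_
        exact hfail _ _ _ _ _ (by omega) fun hp => hzero (hiff.1 hp i (Or.inl rfl))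

end Search

/-! ### The whole run as a chain of lexicographic successors. -/

section Enumeration

variable {n : ℕ} {G : SimpleGraph (Fin n)}

/-- A bound for the time between two outputs. -/
def delayBound (n : ℕ) : ℕ := 20 * n * n + 100 * n + 100

/-- A bound for the number of cells in use just after an output, and for the number of their
bits. -/
def cellBound (n : ℕ) : ℕ := n * n + n + 10

/-- The configuration just after the output of the function given by the packing that the memory
represents. -/
noncomputable def afterOutput (n : ℕ) (m : ℕ →₀ ℕ) (out : List (List ℕ)) : Config :=
  State.toConfig ⟨19, [n, n * n, 0, 0, 0, 0, 0, 0, 1, 0], m, [], out⟩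

theorem bounded_afterOutput {S : Finset (Fin n)} {m : ℕ →₀ ℕ} (hm : Holds G (packingMark G S) m)
    (out : List (List ℕ)) : Bounded (cellBound n) (cellBound n) (afterOutput n m out) := by
  refine ⟨BoundedMap.mono (regs_bounded (s := cellBound n) ?_ ?_) ?_ le_rfl,
    hm.boundedMap (packingMark_le G S)⟩
  · intro v hv
    refine lt_of_le_of_lt (?_ : v ≤ cellBound n) Nat.lt_two_pow_self
    unfold cellBound
    simp only [List.mem_cons, List.not_mem_nil, or_false] at hv
    rcases hv with rfl | rfl | rfl | rfl | rfl | rfl | rfl | rfl | rfl | rfl <;> omega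
  · exact le_trans (by simp [cellBound]) Nat.lt_two_pow_self.le
  · simp [cellBound]

theorem bounded_graphInput (G : SimpleGraph (Fin n)) :
    Bounded (cellBound n) (cellBound n) (graphInput G) := by
  have hreg : (graphInput G).reg = regs [n] := by
    ext a
    rcases a with _ | a <;> simp [graphInput, regs_apply]
  refine ⟨?_, (holds_adjacencyMemory G).boundedMap (packingMark_le G ∅)⟩
  rw [hreg]
  refine BoundedMap.mono (regs_bounded (s := cellBound n) ?_ ?_) ?_ le_rfl
  · intro v hv
    refine lt_of_le_of_lt (?_ : v ≤ cellBound n) Nat.lt_two_pow_self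
    rw [List.mem_singleton] at hv
    unfold cellBound
    omega
  · exact le_trans (by simp [cellBound]) Nat.lt_two_pow_self.le
  · simp [cellBound]

theorem valueList_packingFun (G : SimpleGraph (Fin n)) (S : Finset (Fin n)) :
    (List.ofFn fun v => decodeMark (packingMark G S v)) = valueList (packingFun G S) := by
  simp only [decodeMark_packingMark, valueList]

/-- A run that reaches the output routine outputs the function that the memory represents. -/
theorem Segments.of_reach_output {c : Config} {D : ℕ} {L : List (List ℕ)} {out : List (List ℕ)}
    (hb : Bounded (cellBound n) (cellBound n) c) (hD : D + 10 * n + 5 ≤ delayBound n)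
    (hout : c.out = out)
    (h : Reach enumProgram c D fun c' => ∃ (S : Finset (Fin n)) (m : ℕ →₀ ℕ) (x y : ℕ) (L' : _),
      Holds G (packingMark G S) m ∧
      c' = State.toConfig ⟨6, [n, n * n, 0, 0, 0, x, y, 0, 1, 0], m, [], out⟩ ∧
      L = valueList (packingFun G S) :: L' ∧
      Segments enumProgram (delayBound n) (cellBound n) (cellBound n)
        (afterOutput n m (out ++ [valueList (packingFun G S)])) L') :
    Segments enumProgram (delayBound n) (cellBound n) (cellBound n) c L := by
  obtain ⟨t₁, ht₁, S, m, x, y, L', hm, hc', rfl, hL'⟩ := h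
  obtain ⟨t₂, ht₂, hc''⟩ := reach_output hm n 0 x y (zero_add n) [] out
  rw [← hc', ← run_add, valueList_packingFun, List.drop_zero, List.nil_append] at hc''
  have hnext : run enumProgram c (t₁ + t₂ + 1) =
      afterOutput n m (out ++ [valueList (packingFun G S)]) := by
    rw [run_succ, hc'']
    rfl
  refine Segments.next hb (t₁ + t₂) (by omega) ?_ ?_ ?_
  · rw [hc'']
    rfl
  · rw [hnext, hout]
    rfl
  · rwa [hnext]

open Classical in
-- Induction on the number of sets after `S` in the lexicographic order, which drops when `S` is
-- replaced by its successor.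
theorem exists_segments {S : Finset (Fin n)} (hS : IsPacking G S) {m : ℕ →₀ ℕ}
    (hm : Holds G (packingMark G S) m) (out : List (List ℕ)) :
    ∃ L : List (Finset (Fin n)), L.Nodup ∧ (∀ R, R ∈ L ↔ IsPacking G R ∧ LexLT S R) ∧
      Segments enumProgram (delayBound n) (cellBound n) (cellBound n) (afterOutput n m out)
        (L.map fun R => valueList (packingFun G R)) := by
  induction hN : (Finset.univ.filter fun R => LexLT S R).card using Nat.strong_induction_on
    generalizing S m out with
  | _ N ih =>
    have hb := bounded_afterOutput hm out
    have hbelow : below S n = S := Finset.filter_true_of_mem fun v _ => v.isLt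
    have hsearch : Reach enumProgram (afterOutput n m out) ((20 * n + 40) * n + 3)
        (SearchResult G S out) := by
      refine Reach.goto 2 21 [n, n * n, n, n * n, 0, 0, 0, 0, 1, 0] rfl rfl (by omega) ?_
      refine (reach_search hS n le_rfl ?_ 0 0 0 0 (hbelow.symm ▸ hm) out).mono (by omega)
        fun _ h => h
      intro j hj
      exact absurd j.isLt (not_lt.2 hj)
    -- The search needs the left part; `10 * n + 4` further steps write the item and one step emits
    -- it.
    have hD : (20 * n + 40) * n + 3 + 10 * n + 5 ≤ delayBound n := by
      unfold delayBound
      nlinarith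
    obtain ⟨t, ht, ⟨hno, hhalt⟩ | ⟨i, m', x, y, hext, hiS, hp, hm', hc⟩⟩ := hsearch
    · refine ⟨[], List.nodup_nil, fun R => ?_, Segments.halt hb ⟨t, by omega, hhalt⟩⟩
      simp only [List.not_mem_nil, false_iff, not_and]
      exact hno.not_lexLT
    · have hlt := lexLT_insert_below hiS
      have hcard : (Finset.univ.filter fun R => LexLT (insert i (below S i)) R).card < N := by
        rw [← hN]
        refine Finset.card_lt_card ((Finset.ssubset_iff_of_subset fun R hR => ?_).2
          ⟨insert i (below S i), by simpa using hlt, by simpa using LexLT.irrefl _⟩)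
        rw [Finset.mem_filter] at hR ⊢
        exact ⟨hR.1, hlt.trans hR.2⟩
      obtain ⟨L, hnodup, hmem, hseg⟩ := ih _ hcard hp hm'
        (out ++ [valueList (packingFun G (insert i (below S i)))]) rfl
      · refine ⟨insert i (below S i) :: L, ?_, fun R => ?_, ?_⟩
        · rw [List.nodup_cons]
          exact ⟨fun h => LexLT.irrefl _ ((hmem _).1 h).2, hnodup⟩
        · rw [List.mem_cons, hmem]
          constructor
          · rintro (rfl | ⟨hR, h⟩)
            · exact ⟨hp, hlt⟩
            · exact ⟨hR, hlt.trans h⟩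
          · rintro ⟨hR, h⟩
            exact (hext.lexLT_cases hR h).imp_right fun h => ⟨hR, h⟩
        · rw [List.map_cons]
          exact Segments.of_reach_output hb hD rfl
            ⟨t, ht, _, m', x, y, _, hm', hc, rfl, hseg⟩

/-- The input memory already represents the empty packing, which is the lexicographically least one.
Before its output, the program only computes `n * n`. -/
theorem exists_segments_graphInput (G : SimpleGraph (Fin n)) :
    ∃ L : List (Finset (Fin n)), L.Nodup ∧ (∀ R, R ∈ L ↔ IsPacking G R) ∧
      Segments enumProgram (delayBound n) (cellBound n) (cellBound n) (graphInput G)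
        (L.map fun R => valueList (packingFun G R)) := by
  have hm := holds_adjacencyMemory G
  obtain ⟨L, hnodup, hmem, hseg⟩ :=
    exists_segments (isPacking_empty G) hm ([] ++ [valueList (packingFun G ∅)])
  refine ⟨∅ :: L, ?_, fun R => ?_, ?_⟩
  · rw [List.nodup_cons]
    exact ⟨fun h => LexLT.irrefl _ ((hmem _).1 h).2, hnodup⟩
  · rw [List.mem_cons, hmem]
    constructor
    · rintro (rfl | h)
      · exact isPacking_empty G
      · exact h.1
    · intro hR
      by_cases h : R = ∅
      · exact Or.inl h
      · exact Or.inr ⟨hR, LexLT.empty h⟩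
  · rw [List.map_cons]
    have hinit : graphInput G =
        State.toConfig ⟨0, [n, 0, 0, 0, 0, 0, 0, 0, 0, 0], adjacencyMemory G, [], []⟩ := by
      unfold graphInput State.toConfig
      congr 1
      ext a
      rw [regs_apply]
      rcases a with _ | a
      · simp
      · rcases lt_or_ge a 9 with h | h
        · interval_cases a <;> simp
        · simp [List.getD_eq_getElem?_getD, List.getElem?_eq_none (show
            [n, 0, 0, 0, 0, 0, 0, 0, 0, 0].length ≤ a + 1 by simpa using h)]
    refine Segments.of_reach_output (G := G) (D := 4 * n + 3) (bounded_graphInput G) ?_ rfl ?_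
    · unfold delayBound
      nlinarith
    · rw [hinit]
      refine Reach.goto 2 2 [n, 0, 0, 0, n, 0, 0, 0, 1, 0] rfl rfl (by omega) ?_
      refine (reach_square n n 0 _).mono (by omega) ?_
      rintro c rfl
      refine ⟨∅, _, 0, 0, _, hm, ?_, rfl, hseg⟩
      rw [zero_add]
      rfl

end Enumeration

/-! ### The total running time and the main theorem. -/

theorem card_packings_le {n : ℕ} {G : SimpleGraph (Fin n)} (hG : ∀ v, ¬ G.IsIsolated v)
    {L : List (Finset (Fin n))} (hnodup : L.Nodup) (hmem : ∀ R ∈ L, IsPacking G R) :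
    (L.length : ℝ) ≤ Real.sqrt 3 ^ n := by
  have hle : L.length ≤ (packingsIn G Finset.univ).card := by
    rw [← List.toFinset_card_of_nodup hnodup]
    refine Finset.card_le_card fun R hR => ?_
    exact mem_packingsIn.2 ⟨Finset.subset_univ R, hmem R (List.mem_toFinset.1 hR)⟩
  have h := card_packingsIn_le G Finset.univ fun v _ => by
    by_contra! hno
    exact hG v fun w hw => hno w (Finset.mem_univ w) hw
  rw [Finset.card_univ, Fintype.card_fin] at h
  exact le_trans (by exact_mod_cast hle) h

theorem mainTheorem8 :
    ∃ (P : RAM.Program) (d s q : Polynomial ℕ),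
      ∀ (n : ℕ) (G : SimpleGraph (Fin n)), (∀ v, ¬ G.IsIsolated v) →
        ∃ T : ℕ,
          EnumeratesInTime P G (IsUniqueResponseRomanDominating G) T ∧
          RAM.DelayAtMost P (graphInput G) T (d.eval n) ∧
          (∀ t ≤ T, RAM.space (RAM.run P (graphInput G) t) ≤ s.eval n) ∧
          (T : ℝ) ≤ ((q.eval n : ℕ) : ℝ) * Real.sqrt 3 ^ n := by
  let X : Polynomial ℕ := Polynomial.X
  let d : Polynomial ℕ := 20 * X * X + 100 * X + 100
  let b : Polynomial ℕ := X * X + X + 10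
  have hd : ∀ n, d.eval n = delayBound n := fun n => by simp [d, X, delayBound]
  have hb : ∀ n, b.eval n = cellBound n := fun n => by simp [b, X, cellBound]
  refine ⟨enumProgram, d, (b + d) * (4 * (b + d)), 2 * d, fun n G hG => ?_⟩
  obtain ⟨L, hnodup, hmem, hseg⟩ := exists_segments_graphInput G
  have hsmall : ∀ i ∈ enumProgram, i.Small (2 ^ cellBound n) := fun i hi =>
    (enumProgram_small i hi).mono (le_trans (by simp [cellBound]) Nat.lt_two_pow_self.le)
  obtain ⟨T, hT, hbuf, hout, hle, hspace, hdelay⟩ := hseg.exists_haltsAfter hsmall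
  refine ⟨T, ⟨hT, hbuf, L.map (packingFun G), ?_, fun f => ?_, ?_⟩, ?_, fun t ht => ?_, ?_⟩
  · exact hnodup.map (packingFun_injective G)
  · rw [List.mem_map]
    constructor
    · rintro ⟨S, hS, rfl⟩
      exact ((hmem S).1 hS).isUniqueResponse
    · intro hf
      obtain ⟨S, hS, hSf⟩ := hf.exists_packing
      exact ⟨S, (hmem S).2 hS, hSf⟩
  · rw [hout, List.map_map]
    rfl
  · rw [hd]
    exact hdelay
  · simpa [hd, hb] using hspace t ht
  · have hcard := card_packings_le hG hnodup fun R hR => (hmem R).1 hR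
    -- The run has one segment more than outputs. Since the empty packing is always output,
    -- `L.length + 1 ≤ 2 * L.length`, whence the factor 2 in `q`.
    have hpos : 1 ≤ L.length :=
      List.length_pos_of_mem ((hmem ∅).2 (isPacking_empty G))
    have hle' : T ≤ (2 * d).eval n * L.length := by
      rw [List.length_map] at hle
      rw [Polynomial.eval_mul, hd, Polynomial.eval_ofNat]
      nlinarith
    calc (T : ℝ) ≤ (((2 * d).eval n * L.length : ℕ) : ℝ) := Nat.cast_le.2 hle'
      _ = (((2 * d).eval n : ℕ) : ℝ) * L.length := Nat.cast_mul _ _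
      _ ≤ _ := mul_le_mul_of_nonneg_left hcard (Nat.cast_nonneg _)
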